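/- Let $\mathcal V$ be a finite alphabet, $\mathcal X,\mathcal Y$ discrete alphabets, $c$ a sensor range, $\Psi:\mathcal V^c\to\mathcal X$ a sensing function, $P_{Y|X}(\cdot|x)$ a p.m.f. on $\mathcal Y$ for each $x\in\mathcal X$, and $P_V$ a p.m.f. on $\mathcal V$. A sensor network $s(k,n)$ consists of $n$ sensors, each with $c$ connections (repetitions allowed) to the $k$ positions of a target vector $\boldsymbol v\in\mathcal V^k$. Sensor $\ell$ has ideal output $x_\ell=\Psi(v_{\ell t_1},\dots,v_{\ell t_c})$, and given the ideal outputs the observed outputs $y_\ell$ are independent with laws $P_{Y|X}(\cdot|x_\ell)$. The positions of $\boldsymbol v$ are i.i.d. with distribution $P_V$, and $\boldsymbol v$ is detected from $\boldsymbol y$ by a maximum a posteriori (MAP) detector $g$. For $D\in[0,1]$ there is an error if $\frac1k d_{\mathrm H}(\boldsymbol v,g(\boldsymbol y))\ge D$, where $d_{\mathrm H}$ is the Hamming distance. The sensing capacity $C(D)\in[0,\infty]$ is the largest $C$ such that for every rate $R$ with $0<R<C$ there is a sequence of sensor networks $s(\lceil nR\rceil,n)$ whose error probability under MAP detection, averaged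 over $\boldsymbol v$, tends to $0$ as $n\to\infty$ (however the ties in the MAP rule are broken). Then $$C(D)\ \ge\ C_{LB}(D)=\min_{\lambda}\ \frac{D\left(P_{X_iY}^{\gamma_i}\,\|\,Q_{X_iY}^{\lambda}\right)}{H(\lambda)-H(\gamma_j)-D(\gamma_j\|P_V)},$$ where the minimum is over all p.m.f.s $\lambda=(\lambda_{ab})_{a,b\in\mathcal V}$ with $\sum_b\lambda_{ab}=\gamma_{ia}$ for all $a$ and $\sum_{a\ne b}\lambda_{ab}\ge D$, and it is attained if there is such a $\lambda$ (otherwise $C_{LB}(D)=\infty$). Here $\gamma_i=P_V$, and $\gamma_{jb}=\sum_a\lambda_{ab}$ is the second marginal of $\lambda$. $H$ and $D(\cdot\|\cdot)$ are entropy and Kullback–Leibler distance, in bits. Further, $P^{\gamma}$ is the law of $\Psi(A_1,\dots,A_c)$ for i.i.d. $A_u\sim\gamma$, and $P^\lambda$ is the joint law of $(\Psi(A_1,\dots,A_c),\Psi(B_1,\dots,B_c))$ for i.i.d. pairs $(A_u,B_u)\sim\lambda$; with these, $P^{\gamma}_{X_iY}(x,y)=P^\gamma(x)P_{Y|X}(y|x)$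 and $Q^\lambda_{X_iY}(x,y)=\sum_{a\in\mathcal X}P^\lambda(x,a)P_{Y|X}(y|a)$. The quotient is read as the supremum in $[0,\infty]$ of the rates $R>0$ for which the numerator exceeds $R$ times the denominator: it is $\infty$ if the denominator is negative, and, for a zero denominator, $\infty$ if the numerator is positive and $0$ if it is zero. -/

import Mathlib

open scoped ENNReal NNReal Topology

noncomputable section

namespace SensingCapacity

/-! ### Entropies in bits -/

/-- Shannon entropy, in bits, of a distribution on a finite alphabet. -/
def entropy {α : Type*} [Fintype α] (p : PMF α) : ℝ :=
  (∑ a, Real.negMulLog (p a).toReal) / Real.log 2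

/-- Kullback-Leibler distance `D(p‖q)`, in bits, of two discrete distributions; its value is `∞`
when `p` is not absolutely continuous with respect to `q`. -/
def relEntropy {α : Type*} (p q : PMF α) : ℝ≥0∞ :=
  InformationTheory.klDiv (@PMF.toMeasure α ⊤ p) (@PMF.toMeasure α ⊤ q) /
    ENNReal.ofReal (Real.log 2)

/-- The distribution of `n` independent draws from `p`. -/
def iid {α : Type*} [Fintype α] (n : ℕ) (p : PMF α) : PMF (Fin n → α) :=
  PMF.ofFintype (fun w => ∏ u, p (w u)) (by
    classical
    have h : ∑ a, p a = 1 := by rw [← tsum_fintype (L := .unconditional _), p.tsum_coe]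
    rw [← Fintype.piFinset_univ, Finset.sum_prod_piFinset]
    simp [h])

/-! ### The arbitrary connections model -/

/-- The data of the model: a sensor has range `c`, its ideal output is the function `Ψ` of the `c`
targets that it senses, the observed output is drawn from the noise p.m.f. `noise x = P_{Y|X}(·|x)`
given the ideal output `x`, and target positions are i.i.d. with distribution `prior = P_V`. -/
structure Model (V X Y : Type*) where
  c : ℕ
  Ψ : (Fin c → V) → X
  noise : X → PMF Y
  prior : PMF V

/-- A sensor network `s(k, n)` of range `c`: the `u`-th connection of sensor `ℓ` leads to the target
position `s ℓ u`. A sensor may connect to the same position more than once. -/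
abbrev Network (c k n : ℕ) : Type := Fin n → Fin c → Fin k

namespace Model

variable {V X Y : Type*} (M : Model V X Y)

/-- The codeword (ideal output vector) of the target vector `v` in the sensor network `s`. -/
def codeword {k n : ℕ} (s : Network M.c k n) (v : Fin k → V) : Fin n → X :=
  fun ℓ => M.Ψ (fun u => v (s ℓ u))

/-- The a priori probability of a target vector. -/
def priorProb {k : ℕ} (v : Fin k → V) : ℝ≥0∞ := ∏ t, M.prior (v t)

/-- The probability that the sensor outputs are `y` given that the ideal outputs are `x`. -/
def likelihood {n : ℕ} (x : Fin n → X) (y : Fin n → Y) : ℝ≥0∞ := ∏ ℓ, M.noise (x ℓ) (y ℓ)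

/-- `g` is a maximum a posteriori detector for the network `s`; ties are broken arbitrarily. -/
def IsMAP {k n : ℕ} (s : Network M.c k n) (g : (Fin n → Y) → (Fin k → V)) : Prop :=
  ∀ (y : Fin n → Y) (v : Fin k → V),
    M.priorProb v * M.likelihood (M.codeword s v) y ≤
      M.priorProb (g y) * M.likelihood (M.codeword s (g y)) y

/-- `w` lies in the tolerable distortion region of `v`. -/
def Tolerable [DecidableEq V] (D : ℝ) {k : ℕ} (v w : Fin k → V) : Prop :=
  (hammingDist v w : ℝ) / k < D

open Classical in
/-- The probability of error of the network `s` and the detector `g`, averaged over the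
target vectors according to the prior. -/
def errorProb [Fintype V] [DecidableEq V] (D : ℝ) {k n : ℕ} (s : Network M.c k n)
    (g : (Fin n → Y) → (Fin k → V)) : ℝ≥0∞ :=
  ∑ v : Fin k → V, M.priorProb v *
    ∑' y : Fin n → Y, if Tolerable D v (g y) then 0 else M.likelihood (M.codeword s v) y

/-- There is a sequence of sensor networks `s(⌈nR⌉, n)` whose error probability under MAP detection
(however ties are broken) tends to zero. -/
def Achievable [Fintype V] [DecidableEq V] (D R : ℝ) : Prop :=
  ∃ s : (n : ℕ) → Network M.c ⌈(n : ℝ) * R⌉₊ n,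
    ∀ g : (n : ℕ) → (Fin n → Y) → (Fin ⌈(n : ℝ) * R⌉₊ → V),
      (∀ n, M.IsMAP (s n) (g n)) →
        Filter.Tendsto (fun n => M.errorProb D (s n) (g n)) Filter.atTop (𝓝 0)

/-- The sensing capacity `C(D)` (possibly infinite): the largest rate below which all positive rates
are achievable. -/
def capacity [Fintype V] [DecidableEq V] (D : ℝ) : ℝ≥0∞ :=
  sSup {C : ℝ≥0∞ | ∀ R : ℝ, 0 < R → ENNReal.ofReal R < C → M.Achievable D R}

/-! ### The lower bound -/

variable [Fintype V]

/-- `P^γ`: the law of the ideal output of a sensor whose `c` connections sense i.i.d. targets of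
distribution `γ`. -/
def outputLaw (γ : PMF V) : PMF X := (iid M.c γ).map M.Ψ

/-- `P^λ`: the joint law of the ideal outputs of one random sensor for two target vectors of joint
type `l`. -/
def jointOutputLaw (l : PMF (V × V)) : PMF (X × X) :=
  (iid M.c l).map (fun w => (M.Ψ (fun u => (w u).1), M.Ψ (fun u => (w u).2)))

/-- `P_{X_i Y}^γ (x, y) = P^γ(x) P_{Y|X}(y|x)`. -/
def lawP (γ : PMF V) : PMF (X × Y) :=
  (M.outputLaw γ).bind fun x => (M.noise x).map fun y => (x, y)

/-- `Q_{X_i Y}^λ (x, y) = ∑ a, P^λ(x, a) P_{Y|X}(y|a)`. -/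
def lawQ (l : PMF (V × V)) : PMF (X × Y) :=
  (M.jointOutputLaw l).bind fun x => (M.noise x.2).map fun y => (x.1, y)

/-- The p.m.f.s `λ` on `V × V` with first marginal `P_V` and off-diagonal mass at least `D`. -/
def feasible [DecidableEq V] (D : ℝ) : Set (PMF (V × V)) :=
  {l | l.map Prod.fst = M.prior ∧
    ENNReal.ofReal D ≤ ∑ p : V × V, if p.1 ≠ p.2 then l p else 0}

/-- `H(λ) - H(γ_j) - D(γ_j‖P_V)`, where `γ_j` is the second marginal of `λ`; it may be negative or
`-∞`. -/
def denominator (l : PMF (V × V)) : EReal :=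
  ((entropy l - entropy (l.map Prod.snd) : ℝ) : EReal) -
    ((relEntropy (l.map Prod.snd) M.prior : ℝ≥0∞) : EReal)

/-- The quotient `D(P_{X_i Y}^{P_V} ‖ Q_{X_i Y}^λ) / (H(λ) - H(γ_j) - D(γ_j‖P_V))`, i.e. the
supremum of the rates `R > 0` for which the numerator exceeds `R` times the denominator: it is `∞`
when the denominator is negative, and for a zero denominator it is `∞` if the numerator is positive
and `0` if the numerator is zero. -/
def quotient (l : PMF (V × V)) : ℝ≥0∞ :=
  if M.denominator l < 0 then ∞
  else relEntropy (M.lawP M.prior) (M.lawQ l) / (M.denominator l).toENNReal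

/-- `C_LB(D)`; it is `∞` when there is no feasible `λ`. -/
def lowerBound [DecidableEq V] (D : ℝ) : ℝ≥0∞ := ⨅ l ∈ M.feasible D, M.quotient l

end Model

end SensingCapacity

end

noncomputable section

namespace SensingCapacity

open Filter MeasureTheory InformationTheory

/-! ### Kullback-Leibler distance of discrete distributions -/

/-! The proof is random coding. Draw every connection of every sensor uniformly and independently
among the `k` positions. For target vectors `v`, `w` of joint type `λ` the pairs of ideal outputs
are then i.i.d. over the sensors with law exactly `P^λ`, because connections may repeat. The
averages therefore factor over the sensors into `lawP` and `lawQ`.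

Rivals of the true `v` are treated one joint type at a time. If a rival `w` beats `v`, the
likelihood `L_v` is at most `L_v^(1-ρ) (∑ r_w L_w)^ρ`, with `r_w` the ratio of priors. By Hölder the
average over networks is at most `(∑ r_w)^ρ (∑ P^(1-ρ) Q^ρ)^n` (`random_coding`). The weights `r_w`
of one type sum to at most `exp(k * growth λ)` (`sum_priorProb_div_le`), and `growth` is the
denominator in nats when the first marginal is `P_V`. As `ρ → 0`, `(1 - ∑ P^(1-ρ) Q^ρ) / ρ` tends to
the numerator in nats, so a type is harmless once `R` times the denominator is below the numerator.

This has to hold uniformly in `λ`, although the numerator may be infinite. The approximations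
`klApprox` are lower semicontinuous in `λ`, lie below the distance and come arbitrarily close to it.
Compactness of the simplex then leaves finitely many `ρ`, one margin `δ`, and a neighbourhood of
`P_V` for the first marginal (`exists_uniform_growth_le`). The same semicontinuity shows that the
minimum is attained. Chebyshev's inequality handles atypical `v`, joint types are polynomially many,
and some network is at least as good as the average. -/

theorem sum_coe_eq_one {α : Type*} [Fintype α] (p : PMF α) : ∑ a, p a = 1 := by
  rw [← tsum_fintype (L := .unconditional _), p.tsum_coe]

theorem sum_toReal_eq_one {α : Type*} [Fintype α] (p : PMF α) : ∑ a, (p a).toReal = 1 := by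
  rw [← ENNReal.toReal_sum fun a _ => p.apply_ne_top a, sum_coe_eq_one, ENNReal.toReal_one]

theorem toMeasure_eq_sum_dirac {α : Type*} [MeasurableSpace α] (p : PMF α) :
    p.toMeasure = Measure.sum fun a => p a • Measure.dirac a := by
  ext s hs
  rw [PMF.toMeasure_apply _ hs, Measure.sum_apply _ hs]
  refine tsum_congr fun a => ?_
  by_cases ha : a ∈ s <;> simp [Measure.dirac_apply' _ hs, ha]

theorem lintegral_toMeasure {α : Type*} [MeasurableSpace α] (p : PMF α) {f : α → ℝ≥0∞}
    (hf : Measurable f) : ∫⁻ a, f a ∂p.toMeasure = ∑' a, p a * f a := by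
  rw [toMeasure_eq_sum_dirac, lintegral_sum_measure]
  refine tsum_congr fun a => ?_
  rw [lintegral_smul_measure, lintegral_dirac' a hf, smul_eq_mul]

/-- Kullback-Leibler distance in nats of two discrete distributions. -/
def kl {α : Type*} (p q : PMF α) : ℝ≥0∞ :=
  klDiv (@PMF.toMeasure α ⊤ p) (@PMF.toMeasure α ⊤ q)

theorem kl_eq_top_of_not_ac {α : Type*} {p q : PMF α} {a : α} (hq : q a = 0) (hp : p a ≠ 0) :
    kl p q = ∞ := by
  let _ : MeasurableSpace α := ⊤
  have hs : ∀ s : Set α, MeasurableSet s := fun s => MeasurableSpace.measurableSet_top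
  refine klDiv_of_not_ac fun h => hp ?_
  have := @h {a} (by rw [PMF.toMeasure_apply_singleton _ _ (hs _), hq])
  rwa [PMF.toMeasure_apply_singleton _ _ (hs _)] at this

/-- The `klFun` form has nonnegative terms, so no integrability is needed. The density is determined
only almost everywhere, but integrating it over `{a}` fixes its value wherever `q a ≠ 0`. -/
theorem kl_eq_tsum {α : Type*} {p q : PMF α} (h : ∀ a, q a = 0 → p a = 0) :
    kl p q = ∑' a, ENNReal.ofReal ((q a).toReal * klFun ((p a).toReal / (q a).toReal)) := by
  let _ : MeasurableSpace α := ⊤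
  have hs : ∀ s : Set α, MeasurableSet s := fun s => MeasurableSpace.measurableSet_top
  have hac : p.toMeasure ≪ q.toMeasure := by
    intro s h0
    rw [PMF.toMeasure_apply_eq_zero_iff _ (hs _), Set.disjoint_left] at h0 ⊢
    intro a ha
    exact h0 (a := a) (fun hq => ha (h a hq))
  have hms : ∀ f : α → ℝ≥0∞, Measurable f := fun f s _ => hs _
  rw [kl, klDiv_eq_lintegral_klFun_of_ac hac, lintegral_toMeasure _ (hms _)]
  refine tsum_congr fun a => ?_
  rw [ENNReal.ofReal_mul ENNReal.toReal_nonneg, ENNReal.ofReal_toReal (q.apply_ne_top a)]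
  by_cases hq : q a = 0
  · simp [hq]
  have hd := Measure.setLIntegral_rnDeriv hac {a}
  rw [PMF.toMeasure_apply_singleton _ _ (hs _), ← lintegral_indicator (hs _),
    lintegral_toMeasure _ (hms _), tsum_eq_single a (by intro b hb; simp [hb])] at hd
  rw [← hd]
  simp only [Set.mem_singleton_iff, Set.indicator_of_mem, ENNReal.toReal_mul]
  rw [mul_div_cancel_left₀]
  exact (ENNReal.toReal_ne_zero.2 ⟨hq, q.apply_ne_top a⟩)

/-! ### Rényi-type approximations of the Kullback-Leibler distance from below -/

/-- The weighted arithmetic mean minus the weighted geometric mean. -/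
def meanGap (ρ x y : ℝ) : ℝ := (1 - ρ) * x + ρ * y - x ^ (1 - ρ) * y ^ ρ

theorem meanGap_nonneg {ρ x y : ℝ} (h0 : 0 ≤ ρ) (h1 : ρ ≤ 1) (hx : 0 ≤ x) (hy : 0 ≤ y) :
    0 ≤ meanGap ρ x y := by
  have := Real.geom_mean_le_arith_mean2_weighted (sub_nonneg.2 h1) h0 hx hy (by ring)
  unfold meanGap; linarith

theorem meanGap_eq {ρ x y : ℝ} (hx : 0 < x) (hy : 0 ≤ y) :
    meanGap ρ x y = ρ * (y - x) + x * (1 - (y / x) ^ ρ) := by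
  have : x ^ (1 - ρ) * y ^ ρ = x * (y / x) ^ ρ := by
    rw [Real.div_rpow hy hx.le, Real.rpow_sub hx, Real.rpow_one]; field_simp
  rw [meanGap, this]; ring

theorem mul_klFun_div {x y : ℝ} (hy : 0 < y) :
    y * klFun (x / y) = x * Real.log (x / y) + y - x := by
  rw [klFun_apply]; field_simp

/-- This is `1 + t ≤ exp t` at `t = ρ log (y / x)`. -/
theorem meanGap_le {ρ x y : ℝ} (h1 : ρ < 1) (hx : 0 ≤ x) (hy : 0 < y) :
    meanGap ρ x y ≤ ρ * (y * klFun (x / y)) := by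
  rw [mul_klFun_div hy]
  rcases hx.eq_or_lt with rfl | hx
  · rw [meanGap, Real.zero_rpow (by linarith)]; simp
  rw [meanGap_eq hx hy.le]
  have h := Real.add_one_le_exp (Real.log (y / x) * ρ)
  rw [← Real.rpow_def_of_pos (by positivity)] at h
  have hl : Real.log (x / y) = - Real.log (y / x) := by rw [← Real.log_inv, inv_div]
  rw [hl]
  nlinarith [mul_le_mul_of_nonneg_left h hx.le]

/-- The defect `∑ₐ ((1 - ρ) p(a) + ρ q(a) - p(a)^(1-ρ) q(a)^ρ)`, which equals
`1 - ∑ₐ p(a)^(1-ρ) q(a)^ρ`. -/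
def renyiGap {α : Type*} (ρ : ℝ) (p q : PMF α) : ℝ≥0∞ :=
  ∑' a, ENNReal.ofReal (meanGap ρ (p a).toReal (q a).toReal)

theorem renyiGap_le_kl {α : Type*} {ρ : ℝ} (h0 : 0 < ρ) (h1 : ρ < 1) (p q : PMF α) :
    renyiGap ρ p q ≤ ENNReal.ofReal ρ * kl p q := by
  by_cases h : ∀ a, q a = 0 → p a = 0
  · rw [kl_eq_tsum h, ← ENNReal.tsum_mul_left]
    refine ENNReal.tsum_le_tsum fun a => ?_
    rw [← ENNReal.ofReal_mul h0.le]
    by_cases hq : q a = 0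
    · have h1' : 1 - ρ ≠ 0 := by linarith
      simp [hq, h a hq, meanGap, h0.ne', h1']
    · exact ENNReal.ofReal_le_ofReal (meanGap_le h1 ENNReal.toReal_nonneg
        (ENNReal.toReal_pos hq (q.apply_ne_top a)))
  · push Not at h
    obtain ⟨a, hq, hp⟩ := h
    rw [kl_eq_top_of_not_ac hq hp, ENNReal.mul_top (by simpa using h0)]
    exact le_top

/-- The exponents used are `ρ = 1 / (m + 2)`: they tend to `0` and lie strictly between `0` and `1`
even at `m = 0`. -/
theorem tendsto_inv_add_two : Tendsto (fun m : ℕ => ((m : ℝ) + 2)⁻¹) atTop (𝓝[>] 0) := by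
  refine tendsto_nhdsWithin_iff.2 ⟨?_, Eventually.of_forall fun m => ?_⟩
  · exact tendsto_inv_atTop_zero.comp
      (tendsto_atTop_add_const_right _ _ tendsto_natCast_atTop_atTop)
  · simp only [Set.mem_Ioi]; positivity

/-- The limit is the derivative of `meanGap` at `ρ = 0`, from `(t ^ ρ - 1) / ρ → log t`. -/
theorem tendsto_meanGap {x y : ℝ} (hx : 0 ≤ x) (hy : 0 < y) :
    Tendsto (fun m : ℕ => ((m : ℝ) + 2) * meanGap ((m : ℝ) + 2)⁻¹ x y) atTop
      (𝓝 (y * klFun (x / y))) := by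
  rw [mul_klFun_div hy]
  rcases hx.eq_or_lt with rfl | hx
  · refine tendsto_const_nhds.congr fun m => ?_
    have hm : ((m : ℝ) + 2) ≠ 0 := by positivity
    have : (1 - ((m : ℝ) + 2)⁻¹) ≠ 0 := by
      rw [sub_ne_zero, ne_comm, inv_ne_one]
      have : (0 : ℝ) ≤ m := by positivity
      linarith
    rw [meanGap, Real.zero_rpow this]; field_simp; simp
  · have h := (tendsto_rpow_sub_one_log (x := y / x) (by positivity)).comp tendsto_inv_add_two
    have h2 := (h.const_mul (-x)).const_add (y - x)
    have hl : y - x + -x * Real.log (y / x) = x * Real.log (x / y) + y - x := by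
      rw [← inv_div x y, Real.log_inv]; ring
    rw [hl] at h2
    refine h2.congr fun m => ?_
    have hm : ((m : ℝ) + 2) ≠ 0 := by positivity
    rw [meanGap_eq hx hy.le]
    simp only [Function.comp, inv_inv]
    field_simp
    ring

theorem ofReal_add_two (m : ℕ) : ENNReal.ofReal ((m : ℝ) + 2) = (m : ℝ≥0∞) + 2 := by
  rw [ENNReal.ofReal_add (by positivity) (by positivity)]; simp

/-- A finite partial sum of the distance already exceeds `c`, and finite sums pass to the limit
termwise. Without absolute continuity one bad atom suffices: it contributes `(m + 1) p(a)`, which is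
unbounded. -/
theorem exists_lt_renyiGap {α : Type*} {p q : PMF α} {c : ℝ≥0∞} (hc : c < kl p q) :
    ∃ m : ℕ, c < ((m : ℝ≥0∞) + 2) * renyiGap ((m : ℝ) + 2)⁻¹ p q := by
  by_cases h : ∀ a, q a = 0 → p a = 0
  · rw [kl_eq_tsum h, ENNReal.tsum_eq_iSup_sum] at hc
    obtain ⟨F, hF⟩ := lt_iSup_iff.1 hc
    have ht : Tendsto (fun m : ℕ => ∑ a ∈ F, ENNReal.ofReal
        (((m : ℝ) + 2) * meanGap ((m : ℝ) + 2)⁻¹ (p a).toReal (q a).toReal)) atTop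
        (𝓝 (∑ a ∈ F, ENNReal.ofReal ((q a).toReal * klFun ((p a).toReal / (q a).toReal)))) := by
      refine tendsto_finsetSum _ fun a _ => ENNReal.tendsto_ofReal ?_
      by_cases hq : q a = 0
      · refine tendsto_const_nhds.congr fun m => ?_
        have hm : ((m : ℝ) + 2)⁻¹ ≠ 0 := by positivity
        simp [hq, h a hq, meanGap, Real.zero_rpow hm]
      · exact tendsto_meanGap ENNReal.toReal_nonneg (ENNReal.toReal_pos hq (q.apply_ne_top a))
    obtain ⟨m, hm⟩ := (ht.eventually (lt_mem_nhds hF)).exists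
    refine ⟨m, hm.trans_le ?_⟩
    rw [renyiGap, ← ENNReal.tsum_mul_left, ← ofReal_add_two]
    simp_rw [← ENNReal.ofReal_mul (show (0 : ℝ) ≤ (m : ℝ) + 2 by positivity)]
    exact ENNReal.sum_le_tsum F
  · push Not at h
    obtain ⟨a, hq, hp⟩ := h
    have hp' := ENNReal.toReal_pos hp (p.apply_ne_top a)
    have hc' : c ≠ ∞ := hc.ne_top
    obtain ⟨m, hm⟩ := exists_nat_gt (c.toReal / (p a).toReal)
    refine ⟨m, ?_⟩
    rw [renyiGap, ← ofReal_add_two]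
    refine lt_of_lt_of_le ?_ (mul_le_mul_right (ENNReal.le_tsum a) _)
    rw [← ENNReal.ofReal_mul (by positivity), ENNReal.lt_ofReal_iff_toReal_lt hc', hq, meanGap,
      ENNReal.toReal_zero, Real.zero_rpow (by positivity)]
    rw [div_lt_iff₀ hp'] at hm
    have hm2 : ((m : ℝ) + 2) ≠ 0 := by positivity
    have : ((m : ℝ) + 2) * ((1 - ((m : ℝ) + 2)⁻¹) * (p a).toReal + ((m : ℝ) + 2)⁻¹ * 0
      - (p a).toReal ^ (1 - ((m : ℝ) + 2)⁻¹) * 0) = (m + 1) * (p a).toReal := by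
      field_simp; ring
    rw [this]; linarith

/-- `∑ₐ p(a)^(1-ρ) q(a)^ρ`. -/
def affinity {α : Type*} (ρ : ℝ) (p q : PMF α) : ℝ≥0∞ := ∑' a, p a ^ (1 - ρ) * q a ^ ρ

/-- The linear parts of the gaps sum to `(1 - ρ) + ρ`. -/
theorem renyiGap_add_affinity {α : Type*} {ρ : ℝ} (h0 : 0 ≤ ρ) (h1 : ρ ≤ 1) (p q : PMF α) :
    renyiGap ρ p q + affinity ρ p q = 1 := by
  rw [renyiGap, affinity, ← ENNReal.tsum_add]
  have : ∀ a, ENNReal.ofReal (meanGap ρ (p a).toReal (q a).toReal) + p a ^ (1 - ρ) * q a ^ ρ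
      = ENNReal.ofReal (1 - ρ) * p a + ENNReal.ofReal ρ * q a := by
    intro a
    lift p a to ℝ≥0 using p.apply_ne_top a with x
    lift q a to ℝ≥0 using q.apply_ne_top a with y
    have hx : (x : ℝ≥0∞) = ENNReal.ofReal x := by simp
    have hy : (y : ℝ≥0∞) = ENNReal.ofReal y := by simp
    rw [hx, hy, ENNReal.toReal_ofReal x.coe_nonneg, ENNReal.toReal_ofReal y.coe_nonneg,
      ENNReal.ofReal_rpow_of_nonneg x.coe_nonneg (by linarith),
      ENNReal.ofReal_rpow_of_nonneg y.coe_nonneg h0,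
      ← ENNReal.ofReal_mul (by positivity), ← ENNReal.ofReal_mul (by linarith),
      ← ENNReal.ofReal_mul h0, ← ENNReal.ofReal_add (meanGap_nonneg h0 h1 x.coe_nonneg y.coe_nonneg)
        (by positivity),
      ← ENNReal.ofReal_add (mul_nonneg (by linarith) x.coe_nonneg) (mul_nonneg h0 y.coe_nonneg), meanGap]
    congr 1; ring
  rw [tsum_congr this, ENNReal.tsum_add, ENNReal.tsum_mul_left, ENNReal.tsum_mul_left,
    p.tsum_coe, q.tsum_coe, mul_one, mul_one, ← ENNReal.ofReal_add (by linarith) h0]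
  simp

/-- This is `1 - t ≤ exp (-t)`; for negative `a` the bound is at least `1` and hence trivial. -/
theorem affinity_le {α : Type*} {ρ a : ℝ} (h0 : 0 < ρ) (h1 : ρ ≤ 1) {p q : PMF α}
    (ha : ENNReal.ofReal (ρ * a) ≤ renyiGap ρ p q) :
    affinity ρ p q ≤ ENNReal.ofReal (Real.exp (-(ρ * a))) := by
  have h := renyiGap_add_affinity h0.le h1 p q
  have hZ : affinity ρ p q ≤ 1 - ENNReal.ofReal (ρ * a) := by
    refine (ENNReal.le_sub_iff_add_le_right ENNReal.ofReal_ne_top (ha.trans (h ▸ le_self_add))).2 ?_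
    rw [← h, add_comm]; gcongr
  refine hZ.trans ?_
  rw [← ENNReal.ofReal_one]
  rcases le_total 0 (ρ * a) with hr | hr
  · rw [← ENNReal.ofReal_sub _ hr]
    apply ENNReal.ofReal_le_ofReal
    linarith [Real.add_one_le_exp (-(ρ * a))]
  · rw [ENNReal.ofReal_of_nonpos hr, tsub_zero]
    exact ENNReal.ofReal_le_ofReal (Real.one_le_exp (by linarith))

/-- The correction terms `q(a) - p(a)` cancel because both total masses are `1`. -/
theorem sum_mul_klFun_div {α : Type*} [Fintype α] {p q : PMF α} (h : ∀ a, q a = 0 → p a = 0) :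
    ∑ a, (q a).toReal * klFun ((p a).toReal / (q a).toReal) =
      ∑ a, (p a).toReal * Real.log ((p a).toReal / (q a).toReal) := by
  have : ∀ a, (q a).toReal * klFun ((p a).toReal / (q a).toReal) =
      (p a).toReal * Real.log ((p a).toReal / (q a).toReal) + ((q a).toReal - (p a).toReal) := by
    intro a
    by_cases hq : q a = 0
    · simp [hq, h a hq]
    · rw [mul_klFun_div (ENNReal.toReal_pos hq (q.apply_ne_top a))]; ring
  rw [Finset.sum_congr rfl fun a _ => this a, Finset.sum_add_distrib, Finset.sum_sub_distrib,
    sum_toReal_eq_one, sum_toReal_eq_one]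
  simp

theorem sum_mul_log_div_nonneg {α : Type*} [Fintype α] {p q : PMF α}
    (h : ∀ a, q a = 0 → p a = 0) :
    0 ≤ ∑ a, (p a).toReal * Real.log ((p a).toReal / (q a).toReal) := by
  rw [← sum_mul_klFun_div h]
  exact Finset.sum_nonneg fun a _ =>
    mul_nonneg ENNReal.toReal_nonneg (klFun_nonneg (by positivity))

theorem kl_eq_sum {α : Type*} [Fintype α] {p q : PMF α} (h : ∀ a, q a = 0 → p a = 0) :
    kl p q = ENNReal.ofReal (∑ a, (p a).toReal * Real.log ((p a).toReal / (q a).toReal)) := by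
  rw [kl_eq_tsum h, tsum_fintype, ← ENNReal.ofReal_sum_of_nonneg fun a _ =>
    mul_nonneg ENNReal.toReal_nonneg (klFun_nonneg (by positivity)), sum_mul_klFun_div h]

/-! ### The topology of pointwise convergence on distributions -/

instance instTopologicalSpacePMF {α : Type*} : TopologicalSpace (PMF α) :=
  .induced (fun p a => p a) inferInstance

theorem continuous_pmf_iff {T α : Type*} [TopologicalSpace T] {F : T → PMF α} :
    Continuous F ↔ ∀ a, Continuous fun t => F t a := by
  rw [continuous_induced_rng, continuous_pi_iff]; rfl

theorem continuous_pmf_apply {α : Type*} (a : α) : Continuous fun p : PMF α => p a :=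
  continuous_pmf_iff.1 continuous_id a

theorem continuous_pmf_toReal {α : Type*} (a : α) : Continuous fun p : PMF α => (p a).toReal :=
  ENNReal.continuousOn_toReal.comp_continuous (continuous_pmf_apply a) fun p => p.apply_ne_top a

/-- The simplex is closed in a power of `[0, ∞]`, which is itself compact. -/
instance instCompactSpacePMF {α : Type*} [Fintype α] : CompactSpace (PMF α) := by
  have hi : Topology.IsInducing (fun (p : PMF α) a => p a) := ⟨rfl⟩
  refine ⟨hi.isCompact_iff.2 ?_⟩
  have : (fun (p : PMF α) a => p a) '' Set.univ = {f : α → ℝ≥0∞ | ∑ a, f a = 1} := by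
    ext f
    constructor
    · rintro ⟨p, -, rfl⟩; exact sum_coe_eq_one p
    · intro hf; exact ⟨PMF.ofFintype f hf, trivial, rfl⟩
  rw [this]
  exact (isClosed_eq (continuous_finsetSum _ fun a _ => continuous_apply a)
    continuous_const).isCompact

theorem continuous_bind {α β : Type*} [Fintype α] (κ : α → PMF β) :
    Continuous fun p : PMF α => p.bind κ := by
  refine continuous_pmf_iff.2 fun b => ?_
  simp only [PMF.bind_apply, tsum_fintype]
  exact continuous_finsetSum _ fun a _ =>
    (ENNReal.continuous_mul_const ((κ a).apply_ne_top b)).comp (continuous_pmf_apply a)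

theorem continuous_map {α β : Type*} [Fintype α] (f : α → β) :
    Continuous fun p : PMF α => p.map f :=
  continuous_bind _

theorem continuous_iid {α : Type*} [Fintype α] (n : ℕ) :
    Continuous fun p : PMF α => iid n p := by
  refine continuous_pmf_iff.2 fun w => ?_
  -- Multiplication on `[0, ∞]` is not jointly continuous, so the product is taken in the reals.
  have : ∀ p : PMF α, iid n p w = ENNReal.ofReal (∏ u, (p (w u)).toReal) := by
    intro p
    rw [← ENNReal.toReal_prod, ENNReal.ofReal_toReal]
    · rfl
    · exact ENNReal.prod_ne_top fun u _ => p.apply_ne_top _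
  simp only [this]
  exact ENNReal.continuous_ofReal.comp (continuous_finsetProd _ fun u _ => continuous_pmf_toReal _)

/-- A sum of nonnegative continuous terms is lower semicontinuous; no domination is needed on
infinite alphabets. -/
theorem lowerSemicontinuous_renyiGap {T α : Type*} [TopologicalSpace T] {ρ : ℝ} (h0 : 0 ≤ ρ)
    (h1 : ρ ≤ 1) {F G : T → PMF α} (hF : Continuous F) (hG : Continuous G) :
    LowerSemicontinuous fun t => renyiGap ρ (F t) (G t) := by
  refine lowerSemicontinuous_tsum fun a => Continuous.lowerSemicontinuous ?_
  have hf := (continuous_pmf_toReal a).comp hF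
  have hg := (continuous_pmf_toReal a).comp hG
  refine ENNReal.continuous_ofReal.comp ?_
  unfold meanGap
  exact ((hf.const_mul _).add (hg.const_mul _)).sub
    ((hf.rpow_const fun _ => Or.inr (by linarith)).mul (hg.rpow_const fun _ => Or.inr h0))

theorem inv_add_two_pos (m : ℕ) : 0 < ((m : ℝ) + 2)⁻¹ := by positivity

theorem inv_add_two_lt_one (m : ℕ) : ((m : ℝ) + 2)⁻¹ < 1 :=
  inv_lt_one_of_one_lt₀ (by have : (0 : ℝ) ≤ m := m.cast_nonneg; linarith)

/-- The Rényi-type lower approximations of the Kullback-Leibler distance. -/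
def klApprox {α : Type*} (m : ℕ) (p q : PMF α) : ℝ≥0∞ :=
  ((m : ℝ≥0∞) + 2) * renyiGap ((m : ℝ) + 2)⁻¹ p q

theorem klApprox_le_kl {α : Type*} (m : ℕ) (p q : PMF α) : klApprox m p q ≤ kl p q := by
  have h := renyiGap_le_kl (inv_add_two_pos m) (inv_add_two_lt_one m) p q
  calc klApprox m p q ≤ ((m : ℝ≥0∞) + 2) * (ENNReal.ofReal ((m : ℝ) + 2)⁻¹ * kl p q) := by
        unfold klApprox; gcongr
    _ = kl p q := by
        rw [← mul_assoc, ← ofReal_add_two, ← ENNReal.ofReal_mul (by positivity),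
          mul_inv_cancel₀ (by positivity)]
        simp

theorem lowerSemicontinuous_klApprox {T α : Type*} [TopologicalSpace T] (m : ℕ) {F G : T → PMF α}
    (hF : Continuous F) (hG : Continuous G) :
    LowerSemicontinuous fun t => klApprox m (F t) (G t) := by
  intro t c hc
  have hR := lowerSemicontinuous_renyiGap (inv_add_two_pos m).le (inv_add_two_lt_one m).le hF hG
  have h0 : ((m : ℝ≥0∞) + 2) ≠ 0 := by simp
  have h1 : ((m : ℝ≥0∞) + 2) ≠ ∞ := by simp
  have key : ∀ x : ℝ≥0∞, c < ((m : ℝ≥0∞) + 2) * x ↔ c / ((m : ℝ≥0∞) + 2) < x := fun x => by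
    rw [ENNReal.div_lt_iff (Or.inl h0) (Or.inl h1), mul_comm]
  simp only [klApprox, key] at hc ⊢
  exact hR t _ hc

/-! ### The quotient as a function of the joint type: semicontinuity, attainment and uniform margins
-/

namespace Model

variable {V X Y : Type*} (M : Model V X Y) [Fintype V]

theorem lawP_eq (γ : PMF V) : M.lawP γ =
    (iid M.c γ).bind fun w => (M.noise (M.Ψ w)).map fun y => (M.Ψ w, y) := by
  rw [lawP, outputLaw, PMF.bind_map]; rfl

theorem lawQ_eq (l : PMF (V × V)) : M.lawQ l =
    (iid M.c l).bind fun w => (M.noise (M.Ψ fun u => (w u).2)).map fun y =>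
      (M.Ψ (fun u => (w u).1), y) := by
  rw [lawQ, jointOutputLaw, PMF.bind_map]; rfl

theorem continuous_lawP : Continuous M.lawP := by
  rw [funext M.lawP_eq]
  exact (continuous_bind _).comp (continuous_iid _)

theorem continuous_lawQ : Continuous M.lawQ := by
  rw [funext M.lawQ_eq]
  exact (continuous_bind _).comp (continuous_iid _)

/-- In nats, `H(λ) - H(γ_i) - ∑ γ_i log P_V + ∑ γ_j log P_V`; this is the exponential growth rate of
the number of target vectors of joint type `λ` with a given one, weighted by their prior relative
to that of the given one. -/
def growth (l : PMF (V × V)) : ℝ :=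
  ∑ p, Real.negMulLog (l p).toReal - ∑ a, Real.negMulLog (l.map Prod.fst a).toReal -
    ∑ a, (l.map Prod.fst a).toReal * Real.log (M.prior a).toReal +
    ∑ b, (l.map Prod.snd b).toReal * Real.log (M.prior b).toReal

theorem continuous_growth : Continuous M.growth := by
  have h1 : ∀ a, Continuous fun l : PMF (V × V) => (l.map Prod.fst a).toReal := fun a =>
    (continuous_pmf_toReal a).comp (continuous_map _)
  have h2 : ∀ a, Continuous fun l : PMF (V × V) => (l.map Prod.snd a).toReal := fun a =>
    (continuous_pmf_toReal a).comp (continuous_map _)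
  unfold growth
  exact (((continuous_finsetSum _ fun p _ =>
    Real.continuous_negMulLog.comp (continuous_pmf_toReal p)).sub
    (continuous_finsetSum _ fun a _ => Real.continuous_negMulLog.comp (h1 a))).sub
    (continuous_finsetSum _ fun a _ => (h1 a).mul_const _)).add
    (continuous_finsetSum _ fun a _ => (h2 a).mul_const _)

theorem relEntropy_eq {α : Type*} (p q : PMF α) :
    relEntropy p q = kl p q / ENNReal.ofReal (Real.log 2) := rfl

theorem log_two_pos : 0 < Real.log 2 := Real.log_pos (by norm_num)

/-- When the first marginal is the prior, the two first-marginal terms of `growth` cancel, and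
`-H(γ_j) - D(γ_j‖P_V)` is `∑ γ_j log P_V`. Those terms matter only for types whose first marginal is
merely close to the prior. -/
theorem denominator_eq {l : PMF (V × V)} (h1 : l.map Prod.fst = M.prior)
    (h2 : ∀ b, M.prior b = 0 → l.map Prod.snd b = 0) :
    M.denominator l = ((M.growth l / Real.log 2 : ℝ) : EReal) := by
  rw [denominator, relEntropy_eq, kl_eq_sum h2, ← ENNReal.ofReal_div_of_pos log_two_pos,
    EReal.coe_ennreal_ofReal, max_eq_left (div_nonneg (sum_mul_log_div_nonneg h2) log_two_pos.le),
    ← EReal.coe_sub]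
  congr 1
  have hs : ∀ b, (l.map Prod.snd b).toReal *
      Real.log ((l.map Prod.snd b).toReal / (M.prior b).toReal) =
      -Real.negMulLog (l.map Prod.snd b).toReal -
        (l.map Prod.snd b).toReal * Real.log (M.prior b).toReal := by
    intro b
    by_cases hl : l.map Prod.snd b = 0
    · simp [hl]
    · have hp : M.prior b ≠ 0 := fun h => hl (h2 b h)
      rw [Real.log_div (ENNReal.toReal_ne_zero.2 ⟨hl, PMF.apply_ne_top _ _⟩)
        (ENNReal.toReal_ne_zero.2 ⟨hp, PMF.apply_ne_top _ _⟩), Real.negMulLog]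
      ring
  have h0 : ∑ a, Real.negMulLog (M.prior a).toReal +
      ∑ a, (M.prior a).toReal * Real.log (M.prior a).toReal = 0 := by
    rw [← Finset.sum_add_distrib]
    exact Finset.sum_eq_zero fun a _ => by rw [Real.negMulLog]; ring
  rw [Finset.sum_congr rfl fun b _ => hs b, growth, h1, entropy, entropy, ← sub_div, ← sub_div,
    Finset.sum_sub_distrib, Finset.sum_neg_distrib]
  congr 1
  linarith

theorem quotient_eq_top {l : PMF (V × V)} {b : V} (hb : M.prior b = 0)
    (hl : l.map Prod.snd b ≠ 0) : M.quotient l = ∞ := by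
  rw [quotient, if_pos]
  rw [denominator, relEntropy_eq, kl_eq_top_of_not_ac hb hl, ENNReal.top_div_of_ne_top (by simp)]
  simp

/-- The factors `log 2` cancel. The resulting alternative is free of division and stable under small
changes of `l`. -/
theorem lt_quotient_iff {l : PMF (V × V)} (h1 : l.map Prod.fst = M.prior)
    (h2 : ∀ b, M.prior b = 0 → l.map Prod.snd b = 0) {r : ℝ} (hr : 0 ≤ r) :
    ENNReal.ofReal r < M.quotient l ↔ M.growth l < 0 ∨
      ENNReal.ofReal (r * M.growth l) < kl (M.lawP (l.map Prod.fst)) (M.lawQ l) := by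
  have hL := log_two_pos
  rw [quotient, denominator_eq M h1 h2, h1]
  have hn : ((M.growth l / Real.log 2 : ℝ) : EReal) < 0 ↔ M.growth l < 0 := by
    rw [← EReal.coe_zero, EReal.coe_lt_coe_iff, div_lt_iff₀ hL, zero_mul]
  by_cases h : M.growth l < 0
  · rw [if_pos (hn.2 h)]; simp [h]
  · rw [if_neg (hn.not.2 h), EReal.toENNReal_of_ne_top (EReal.coe_ne_top _), EReal.toReal_coe]
    push Not at h
    simp only [not_lt.2 h, false_or]
    rw [ENNReal.lt_div_iff_mul_lt (Or.inr ENNReal.ofReal_ne_top) (Or.inl ENNReal.ofReal_ne_top),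
      relEntropy_eq, ENNReal.lt_div_iff_mul_lt (Or.inr (ENNReal.mul_ne_top ENNReal.ofReal_ne_top
        ENNReal.ofReal_ne_top)) (Or.inl ENNReal.ofReal_ne_top), ← ENNReal.ofReal_mul hr,
      ← ENNReal.ofReal_mul (by positivity), mul_assoc, div_mul_cancel₀ _ hL.ne']

/-- The strict inequality leaves room for some `a` between the two sides; continuity of `growth` and
semicontinuity of `klApprox` carry it to a neighbourhood. -/
theorem exists_eventually_growth_le {l : PMF (V × V)} {r : ℝ} (h : M.growth l < 0 ∨
      ENNReal.ofReal (r * M.growth l) < kl (M.lawP (l.map Prod.fst)) (M.lawQ l)) (hr : 0 < r) :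
    ∃ (m : ℕ) (a δ : ℝ), 0 < δ ∧ ∀ᶠ l' in 𝓝 l, r * M.growth l' ≤ a - δ ∧
      ENNReal.ofReal a ≤ klApprox m (M.lawP (l'.map Prod.fst)) (M.lawQ l') := by
  have hcont : Continuous fun l => r * M.growth l := M.continuous_growth.const_mul r
  have close : ∀ a, r * M.growth l < a → ∃ δ > 0, ∀ᶠ l' in 𝓝 l, r * M.growth l' ≤ a - δ := by
    intro a ha
    refine ⟨(a - r * M.growth l) / 2, by linarith, ?_⟩
    filter_upwards [hcont.continuousAt.eventually (gt_mem_nhds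
      (show r * M.growth l < a - (a - r * M.growth l) / 2 by linarith))] with l' hl'
    exact hl'.le
  by_cases hg : M.growth l < 0
  · have hneg : r * M.growth l < 0 := mul_neg_of_pos_of_neg hr hg
    obtain ⟨δ, hδ, hev⟩ := close 0 hneg
    -- For negative growth `a = 0` works, since `klApprox` is nonnegative.
    exact ⟨0, 0, δ, hδ, hev.mono fun l' hl' => ⟨hl', by simp⟩⟩
  · replace h := h.resolve_left hg
    obtain ⟨m, hm⟩ := exists_lt_renyiGap h
    obtain ⟨a, ha0, ha1, ha2⟩ := ENNReal.lt_iff_exists_real_btwn.1 hm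
    have hlt : r * M.growth l < a := by
      rw [ENNReal.ofReal_lt_ofReal_iff_of_nonneg (mul_nonneg hr.le (not_lt.1 hg))] at ha1
      exact ha1
    obtain ⟨δ, hδ, hev⟩ := close a hlt
    refine ⟨m, a, δ, hδ, ?_⟩
    have hl := lowerSemicontinuous_klApprox m
      (M.continuous_lawP.comp (continuous_map (Prod.fst : V × V → V))) M.continuous_lawQ l _ ha2
    filter_upwards [hev, hl] with l' h1 h2
    exact ⟨h1, h2.le⟩

/-- The joint distributions with off-diagonal mass at least `D` whose second marginal is absolutely
continuous with respect to the prior. -/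
def confusable [DecidableEq V] (D : ℝ) : Set (PMF (V × V)) :=
  {l | (∀ b, M.prior b = 0 → l.map Prod.snd b = 0) ∧
    ENNReal.ofReal D ≤ ∑ p : V × V, if p.1 ≠ p.2 then l p else 0}

theorem isClosed_confusable [DecidableEq V] (D : ℝ) : IsClosed (M.confusable D) := by
  have : M.confusable D = (⋂ b, ⋂ (_ : M.prior b = 0), {l | l.map Prod.snd b = 0}) ∩
      {l | ENNReal.ofReal D ≤ ∑ p : V × V, if p.1 ≠ p.2 then l p else 0} := by
    ext l; simp only [confusable, Set.mem_inter_iff, Set.mem_iInter, Set.mem_ofPred_eq]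
  rw [this]
  refine IsClosed.inter ?_ ?_
  · exact isClosed_iInter fun b => isClosed_iInter fun _ => isClosed_eq
      ((continuous_pmf_apply b).comp (continuous_map _)) continuous_const
  · refine isClosed_le continuous_const (continuous_finsetSum _ fun p _ => ?_)
    split_ifs
    · exact continuous_pmf_apply p
    · exact continuous_const

theorem isClosed_confusable_inter [DecidableEq V] (D : ℝ) :
    IsClosed (M.confusable D ∩ {l | l.map Prod.fst = M.prior}) := by
  refine (M.isClosed_confusable D).inter ?_
  have : {l : PMF (V × V) | l.map Prod.fst = M.prior} =
      ⋂ a, {l | l.map Prod.fst a = M.prior a} := by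
    ext l; simp [PMF.ext_iff]
  rw [this]
  exact isClosed_iInter fun a => isClosed_eq
    ((continuous_pmf_apply a).comp (continuous_map _)) continuous_const

theorem lowerSemicontinuousOn_quotient [DecidableEq V] (D : ℝ) :
    LowerSemicontinuousOn M.quotient (M.confusable D ∩ {l | l.map Prod.fst = M.prior}) := by
  rintro l ⟨hl, hl1⟩ c hc
  obtain ⟨r, hr, hcr, hrl⟩ := ENNReal.lt_iff_exists_real_btwn.1 hc
  have hr0 : 0 < r := ENNReal.ofReal_pos.1 (bot_le.trans_lt hcr)
  obtain ⟨m, a, δ, hδ, hev⟩ :=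
    M.exists_eventually_growth_le ((M.lt_quotient_iff hl1 hl.1 hr).1 hrl) hr0
  filter_upwards [hev.filter_mono nhdsWithin_le_nhds, self_mem_nhdsWithin] with l' h hl'
  refine hcr.trans ((M.lt_quotient_iff hl'.2 hl'.1.1 hr).2 ?_)
  by_cases hg : M.growth l' < 0
  · exact Or.inl hg
  · refine Or.inr (lt_of_lt_of_le ?_ (h.2.trans (klApprox_le_kl _ _ _)))
    rw [ENNReal.ofReal_lt_ofReal_iff_of_nonneg (mul_nonneg hr (not_lt.1 hg))]
    linarith [h.1]

theorem exists_quotient_eq_lowerBound [DecidableEq V] {D : ℝ} (h : (M.feasible D).Nonempty) :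
    ∃ l ∈ M.feasible D, M.quotient l = M.lowerBound D := by
  have split : ∀ l ∈ M.feasible D, l ∈ M.confusable D ∩ {l | l.map Prod.fst = M.prior} ∨
      M.quotient l = ∞ := by
    intro l hl
    by_cases hc : ∀ b, M.prior b = 0 → l.map Prod.snd b = 0
    · exact Or.inl ⟨⟨hc, hl.2⟩, hl.1⟩
    · push Not at hc
      obtain ⟨b, hb, hlb⟩ := hc
      exact Or.inr (M.quotient_eq_top hb hlb)
  rcases (M.confusable D ∩ {l | l.map Prod.fst = M.prior}).eq_empty_or_nonempty with he | hne
  -- Every feasible point then has value `∞`, so any of them attains the infimum.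
  · have htop : ∀ l ∈ M.feasible D, M.quotient l = ∞ := fun l hl =>
      (split l hl).resolve_left (by simp [he])
    obtain ⟨l, hl⟩ := h
    refine ⟨l, hl, le_antisymm (le_iInf₂ fun l' hl' => ?_) (iInf₂_le l hl)⟩
    rw [htop l' hl']; exact le_top
  · obtain ⟨l, hl, hmin⟩ := (M.lowerSemicontinuousOn_quotient D).exists_isMinOn hne
      (M.isClosed_confusable_inter D).isCompact
    have hlf : l ∈ M.feasible D := ⟨hl.2, hl.1.2⟩
    refine ⟨l, hlf, le_antisymm (le_iInf₂ fun l' hl' => ?_) (iInf₂_le l hlf)⟩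
    rcases split l' hl' with h' | h'
    · exact hmin h'
    · rw [h']; exact le_top

/-- Below the lower bound, the growth rate is beaten by the error exponent, uniformly over all joint
distributions whose first marginal is close to the prior. -/
theorem exists_uniform_growth_le [DecidableEq V] {D R : ℝ} (hR : 0 < R)
    (h : ENNReal.ofReal R < M.lowerBound D) :
    ∃ (N : ℕ) (δ ε : ℝ), 0 < δ ∧ 0 < ε ∧ ∀ l ∈ M.confusable D,
      (∀ a, |(l.map Prod.fst a).toReal - (M.prior a).toReal| < ε) → ∃ m ≤ N, ∃ a : ℝ,
        R * M.growth l ≤ a - δ ∧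
          ENNReal.ofReal a ≤ klApprox m (M.lawP (l.map Prod.fst)) (M.lawQ l) := by
  set K := M.confusable D ∩ {l | l.map Prod.fst = M.prior}
  have hK : IsCompact K := (M.isClosed_confusable_inter D).isCompact
  have near : ∃ (N : ℕ) (δ : ℝ), 0 < δ ∧ ∀ᶠ l in 𝓝ˢ K, ∃ m ≤ N, ∃ a : ℝ,
      R * M.growth l ≤ a - δ ∧
        ENNReal.ofReal a ≤ klApprox m (M.lawP (l.map Prod.fst)) (M.lawQ l) := by
    -- Compact induction: a union takes the larger `N` and the smaller `δ`.
    refine hK.induction_on (p := fun s => ∃ (N : ℕ) (δ : ℝ), 0 < δ ∧ ∀ᶠ l in 𝓝ˢ s, ∃ m ≤ N,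
      ∃ a : ℝ, R * M.growth l ≤ a - δ ∧
        ENNReal.ofReal a ≤ klApprox m (M.lawP (l.map Prod.fst)) (M.lawQ l)) ?_ ?_ ?_ ?_
    · exact ⟨0, 1, one_pos, by simp⟩
    · rintro s t hst ⟨N, δ, hδ, ht⟩
      exact ⟨N, δ, hδ, ht.filter_mono (nhdsSet_mono hst)⟩
    · rintro s t ⟨N, δ, hδ, hs⟩ ⟨N', δ', hδ', ht⟩
      refine ⟨max N N', min δ δ', lt_min hδ hδ', ?_⟩
      rw [nhdsSet_union, eventually_sup]
      constructor
      · filter_upwards [hs] with l ⟨m, hm, a, h1, h2⟩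
        exact ⟨m, hm.trans (le_max_left _ _), a, h1.trans (by linarith [min_le_left δ δ']), h2⟩
      · filter_upwards [ht] with l ⟨m, hm, a, h1, h2⟩
        exact ⟨m, hm.trans (le_max_right _ _), a, h1.trans (by linarith [min_le_right δ δ']), h2⟩
    · rintro l ⟨hl, hl1⟩
      have hq : ENNReal.ofReal R < M.quotient l :=
        h.trans_le (iInf₂_le l ⟨hl1, hl.2⟩)
      obtain ⟨m, a, δ, hδ, hev⟩ :=
        M.exists_eventually_growth_le ((M.lt_quotient_iff hl1 hl.1 hR.le).1 hq) hR
      obtain ⟨U, hU, hUo, hlU⟩ := eventually_nhds_iff.1 hev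
      refine ⟨U, mem_nhdsWithin_of_mem_nhds (hUo.mem_nhds hlU), m, δ, hδ, ?_⟩
      rw [hUo.nhdsSet_eq, eventually_principal]
      exact fun l' hl' => ⟨m, le_rfl, a, hU l' hl'⟩
  obtain ⟨N, δ, hδ, hev⟩ := near
  obtain ⟨O, hO, hKO, hOp⟩ := eventually_nhdsSet_iff_exists.1 hev
  -- Away from `O` the first marginal never equals the prior, so its distance to the prior has a
  -- positive minimum `η` on this compact set.
  have hC : IsCompact (M.confusable D \ O) := ((M.isClosed_confusable D).sdiff hO).isCompact
  have hcd : Continuous fun l : PMF (V × V) =>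
      ∑ a, |(l.map Prod.fst a).toReal - (M.prior a).toReal| :=
    continuous_finsetSum _ fun a _ =>
      (((continuous_pmf_toReal a).comp (continuous_map _)).sub continuous_const).abs
  obtain ⟨η, hη, hηC⟩ : ∃ η > 0, ∀ l ∈ M.confusable D \ O,
      η ≤ ∑ a, |(l.map Prod.fst a).toReal - (M.prior a).toReal| := by
    rcases (M.confusable D \ O).eq_empty_or_nonempty with he | hne
    · exact ⟨1, one_pos, by simp [he]⟩
    · obtain ⟨l, hl, hmin⟩ := hC.exists_isMinOn hne hcd.continuousOn
      refine ⟨_, ?_, fun l' hl' => hmin hl'⟩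
      refine lt_of_le_of_ne (Finset.sum_nonneg fun a _ => abs_nonneg _) fun h0 => hl.2 (hKO
        ⟨hl.1, PMF.ext fun a => ?_⟩)
      have := (Finset.sum_eq_zero_iff_of_nonneg fun a _ => abs_nonneg _).1 h0.symm a
        (Finset.mem_univ a)
      rwa [abs_eq_zero, sub_eq_zero, ENNReal.toReal_eq_toReal_iff' (PMF.apply_ne_top _ _)
        (PMF.apply_ne_top _ _)] at this
  refine ⟨N, δ, η / (Fintype.card V + 1), hδ, by positivity, fun l hl hclose => hOp l ?_⟩
  by_contra hlO
  have h1 := hηC l ⟨hl, hlO⟩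
  have h2 : ∑ a, |(l.map Prod.fst a).toReal - (M.prior a).toReal| ≤
      ∑ _a : V, η / (Fintype.card V + 1) := Finset.sum_le_sum fun a _ => (hclose a).le
  rw [Finset.sum_const, Finset.card_univ, nsmul_eq_mul, mul_div_assoc'] at h2
  have h3 : (Fintype.card V : ℝ) * η / (Fintype.card V + 1) < η := by
    rw [div_lt_iff₀ (by positivity)]; nlinarith
  linarith

end Model

/-! ### Sums over product alphabets -/

theorem tsum_pi_prod {α : Type*} : ∀ {n : ℕ} (g : Fin n → α → ℝ≥0∞),
    ∑' f : Fin n → α, ∏ i, g i (f i) = ∏ i, ∑' a, g i a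
  | 0, g => by
    rw [tsum_eq_single (fun i => Fin.elim0 i) fun f hf => (hf (Subsingleton.elim _ _)).elim]
    simp
  | n + 1, g => by
    rw [← (Fin.consEquiv fun _ => α).tsum_eq, ENNReal.tsum_prod', Fin.prod_univ_succ]
    simp only [Fin.consEquiv, Equiv.coe_fn_mk, Fin.prod_univ_succ, Fin.cons_zero, Fin.cons_succ]
    simp_rw [ENNReal.tsum_mul_left, tsum_pi_prod fun i => g i.succ, ENNReal.tsum_mul_right]

theorem sum_pi_prod {α R : Type*} [Fintype α] [CommSemiring R] {n : ℕ} (g : Fin n → α → R) :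
    ∑ f : Fin n → α, ∏ i, g i (f i) = ∏ i, ∑ a, g i a := by
  classical
  rw [Finset.prod_univ_sum, Fintype.piFinset_univ]

theorem iid_apply {α : Type*} [Fintype α] (n : ℕ) (p : PMF α) (w : Fin n → α) :
    iid n p w = ∏ u, p (w u) := rfl

theorem iid_map {α β : Type*} [Fintype α] [Fintype β] (n : ℕ) (p : PMF α) (f : α → β) :
    iid n (p.map f) = (iid n p).map fun w u => f (w u) := by
  classical
  ext w
  rw [iid_apply, PMF.map_apply, tsum_fintype]
  simp only [PMF.map_apply, tsum_fintype]
  rw [← sum_pi_prod]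
  refine Finset.sum_congr rfl fun τ _ => ?_
  rw [Finset.prod_ite_zero]
  simp [funext_iff, iid_apply]

/-- With `iid_map`, this identifies i.i.d. draws from an empirical distribution with reading a word
at uniformly chosen positions. -/
theorem iid_uniform {α : Type*} [Fintype α] [Nonempty α] (n : ℕ) :
    iid n (PMF.uniformOfFintype α) = PMF.uniformOfFintype (Fin n → α) := by
  classical
  ext w
  simp [iid_apply, ENNReal.inv_pow]

/-! ### Empirical distributions -/

/-- The empirical distribution of a word. -/
def empirical {α : Type*} {k : ℕ} [NeZero k] (f : Fin k → α) : PMF α :=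
  (PMF.uniformOfFintype (Fin k)).map f

theorem map_empirical {α β : Type*} {k : ℕ} [NeZero k] (f : Fin k → α) (h : α → β) :
    (empirical f).map h = empirical fun t => h (f t) := by
  rw [empirical, PMF.map_comp]; rfl

open Classical in
theorem empirical_apply {α : Type*} {k : ℕ} [NeZero k] (f : Fin k → α) (a : α) :
    empirical f a = (Finset.univ.filter fun t => f t = a).card / k := by
  rw [empirical, PMF.map_apply, tsum_fintype]
  simp only [PMF.uniformOfFintype_apply, Fintype.card_fin]
  rw [← Finset.sum_filter, Finset.sum_const, nsmul_eq_mul, div_eq_mul_inv]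
  simp [eq_comm]

theorem empirical_apply_ne_zero {α : Type*} {k : ℕ} [NeZero k] (f : Fin k → α) (t : Fin k) :
    empirical f (f t) ≠ 0 := by
  rw [← PMF.mem_support_iff, empirical, PMF.mem_support_map_iff]
  exact ⟨t, by simp, rfl⟩

theorem sum_eq_mul_sum_empirical {α : Type*} [Fintype α] {k : ℕ} [NeZero k] (f : Fin k → α)
    (h : α → ℝ) : ∑ t, h (f t) = k * ∑ a, (empirical f a).toReal * h a := by
  classical
  have hk : (k : ℝ) ≠ 0 := by exact_mod_cast NeZero.ne k
  rw [← Finset.sum_fiberwise_of_maps_to (t := Finset.univ) (g := f) (fun _ _ => Finset.mem_univ _),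
    Finset.mul_sum]
  refine Finset.sum_congr rfl fun a _ => ?_
  rw [Finset.sum_congr rfl (g := fun _ => h a) fun t ht => by rw [(Finset.mem_filter.1 ht).2],
    Finset.sum_const, nsmul_eq_mul, empirical_apply, ENNReal.toReal_div]
  simp only [ENNReal.toReal_natCast]
  field_simp

/-- An empirical distribution is determined by its letter counts, each in `{0, …, k}`. -/
theorem card_image_empirical_le {α β : Type*} [Fintype α] {k : ℕ} [NeZero k] [Fintype β]
    [DecidableEq (PMF α)] (s : Finset β) (h : β → Fin k → α) :
    (s.image fun w => empirical (h w)).card ≤ (k + 1) ^ Fintype.card α := by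
  classical
  let N : β → α → Fin (k + 1) := fun w a => ⟨(Finset.univ.filter fun t => h w t = a).card,
    Nat.lt_succ_of_le ((Finset.card_le_univ _).trans_eq (Fintype.card_fin k))⟩
  have hf : Function.FactorsThrough (fun w => empirical (h w)) N := by
    intro w w' hw
    ext a
    have := congr_arg Fin.val (congr_fun hw a)
    simp only [N] at this
    rw [empirical_apply, empirical_apply, this]
  rcases s.eq_empty_or_nonempty with rfl | ⟨w₀, -⟩
  · simp
  have : (fun w => empirical (h w)) =
      Function.extend N (fun w => empirical (h w)) (fun _ => empirical (h w₀)) ∘ N :=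
    funext fun w => (hf.extend_apply _ w).symm
  rw [this, ← Finset.image_image]
  refine Finset.card_image_le.trans ((Finset.card_le_univ _).trans ?_)
  simp

namespace Model

variable {V X Y : Type*} (M : Model V X Y)

/-! ### Random networks -/

section RandomNetwork

open Classical

theorem noise_map_apply (z x' x : X) (y : Y) :
    ((M.noise z).map fun y => (x', y)) (x, y) = if x = x' then M.noise z y else 0 := by
  rw [PMF.map_apply]
  by_cases h : x = x'
  · rw [tsum_eq_single y (by intro b hb; simp [hb.symm])]; simp [h]
  · simp [h]

theorem card_network_inv {k n : ℕ} : (Fintype.card (Network M.c k n) : ℝ≥0∞)⁻¹ =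
    ∏ _ℓ : Fin n, (Fintype.card (Fin M.c → Fin k) : ℝ≥0∞)⁻¹ := by
  rw [Finset.prod_const, Finset.card_univ, Fintype.card_fin, ← ENNReal.inv_pow]
  simp [Network]

/-- A uniform network is a family of independent uniform sensors, and the event that `v` has
codeword `x` is a product event, so the average factors. -/
theorem sum_network_prod {k n : ℕ} (v : Fin k → V) (x : Fin n → X)
    (h : Fin n → (Fin M.c → Fin k) → ℝ≥0∞) :
    ∑ s : Network M.c k n, (if M.codeword s v = x then
        (Fintype.card (Network M.c k n) : ℝ≥0∞)⁻¹ else 0) * ∏ ℓ, h ℓ (s ℓ) =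
      ∏ ℓ, ∑ τ : Fin M.c → Fin k, (Fintype.card (Fin M.c → Fin k) : ℝ≥0∞)⁻¹ *
        if x ℓ = M.Ψ (fun u => v (τ u)) then h ℓ τ else 0 := by
  rw [← sum_pi_prod]
  refine Finset.sum_congr rfl fun s _ => ?_
  rw [Finset.prod_mul_distrib, ← card_network_inv, Finset.prod_ite_zero]
  simp only [funext_iff, codeword, Finset.mem_univ, true_imp_iff, eq_comm (b := x _)]
  split_ifs <;> simp

variable [Fintype V] {k n : ℕ} [NeZero k]

theorem lawQ_empirical_apply (v w : Fin k → V) (x : X) (y : Y) :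
    M.lawQ (empirical fun t => (v t, w t)) (x, y) =
      ∑ τ : Fin M.c → Fin k, (Fintype.card (Fin M.c → Fin k) : ℝ≥0∞)⁻¹ *
        if x = M.Ψ (fun u => v (τ u)) then M.noise (M.Ψ fun u => w (τ u)) y else 0 := by
  rw [lawQ_eq, empirical, iid_map, iid_uniform, PMF.bind_map, PMF.bind_apply, tsum_fintype]
  simp only [Function.comp, noise_map_apply, PMF.uniformOfFintype_apply]

theorem lawP_empirical_apply (v : Fin k → V) (x : X) (y : Y) :
    M.lawP (empirical v) (x, y) = M.noise x y *
      ∑ τ : Fin M.c → Fin k, (Fintype.card (Fin M.c → Fin k) : ℝ≥0∞)⁻¹ *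
        if x = M.Ψ (fun u => v (τ u)) then 1 else 0 := by
  rw [lawP_eq, empirical, iid_map, iid_uniform, PMF.bind_map, PMF.bind_apply, tsum_fintype,
    Finset.mul_sum]
  simp only [Function.comp, noise_map_apply, PMF.uniformOfFintype_apply]
  refine Finset.sum_congr rfl fun τ _ => ?_
  split_ifs with h
  · rw [h]; ring
  · simp

/-- Conditioning on the codeword `x` of `v` freezes the true likelihood; concavity of `t ^ ρ` then
moves the average over networks inside the power. -/
theorem random_coding_pointwise {ρ : ℝ} (h0 : 0 < ρ) (h1 : ρ < 1) (v : Fin k → V)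
    (W : Finset (Fin k → V)) (r : (Fin k → V) → ℝ≥0∞) {l : PMF (V × V)}
    (hW : ∀ w ∈ W, empirical (fun t => (v t, w t)) = l) (x : Fin n → X) (y : Fin n → Y) :
    ∑ s : Network M.c k n, (if M.codeword s v = x then
        (Fintype.card (Network M.c k n) : ℝ≥0∞)⁻¹ else 0) * (M.likelihood x y ^ (1 - ρ) *
          (∑ w ∈ W, r w * M.likelihood (M.codeword s w) y) ^ ρ) ≤
      (∑ w ∈ W, r w) ^ ρ * ∏ ℓ, (M.lawP (empirical v) (x ℓ, y ℓ) ^ (1 - ρ) *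
        M.lawQ l (x ℓ, y ℓ) ^ ρ) := by
  have h1' : 0 ≤ 1 - ρ := by linarith
  set u : Network M.c k n → ℝ≥0∞ := fun s => if M.codeword s v = x then
        (Fintype.card (Network M.c k n) : ℝ≥0∞)⁻¹ else 0 with hu
  set B : Network M.c k n → ℝ≥0∞ := fun s => ∑ w ∈ W, r w * M.likelihood (M.codeword s w) y with hB
  have hP : M.likelihood x y * ∑ s, u s = ∏ ℓ, M.lawP (empirical v) (x ℓ, y ℓ) := by
    have := M.sum_network_prod (n := n) v x fun _ _ => 1
    simp only [Finset.prod_const_one, mul_one] at this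
    rw [hu, this, likelihood, ← Finset.prod_mul_distrib]
    exact Finset.prod_congr rfl fun ℓ _ => (M.lawP_empirical_apply v _ _).symm
  have hQ : ∑ s, u s * B s = (∑ w ∈ W, r w) * ∏ ℓ, M.lawQ l (x ℓ, y ℓ) := by
    simp only [hB, Finset.mul_sum]
    rw [Finset.sum_comm, Finset.sum_mul]
    refine Finset.sum_congr rfl fun w hw => ?_
    have := M.sum_network_prod (n := n) v x fun ℓ τ => M.noise (M.Ψ fun u => w (τ u)) (y ℓ)
    simp only [← M.lawQ_empirical_apply v w, hW w hw] at this
    rw [← this, Finset.mul_sum]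
    refine Finset.sum_congr rfl fun s _ => ?_
    rw [mul_left_comm]; rfl
  -- Jensen's inequality for the unnormalised weights `u`, as Hölder with exponent `1 / ρ`.
  have hH : ∑ s, u s * B s ^ ρ ≤ (∑ s, u s) ^ (1 - ρ) * (∑ s, u s * B s) ^ ρ := by
    have := ENNReal.inner_le_weight_mul_Lp_of_nonneg Finset.univ (p := ρ⁻¹)
      ((one_le_inv₀ h0).2 h1.le) u (fun s => B s ^ ρ)
    simpa only [inv_inv, ← ENNReal.rpow_mul, mul_inv_cancel₀ h0.ne', ENNReal.rpow_one] using this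
  calc ∑ s, u s * (M.likelihood x y ^ (1 - ρ) * B s ^ ρ)
      = M.likelihood x y ^ (1 - ρ) * ∑ s, u s * B s ^ ρ := by
        rw [Finset.mul_sum]; exact Finset.sum_congr rfl fun s _ => by ring
    _ ≤ M.likelihood x y ^ (1 - ρ) * ((∑ s, u s) ^ (1 - ρ) * (∑ s, u s * B s) ^ ρ) := by gcongr
    _ = _ := by
        rw [← mul_assoc, ← ENNReal.mul_rpow_of_nonneg _ _ h1', hP, hQ,
          ENNReal.mul_rpow_of_nonneg _ _ h0.le, ← ENNReal.prod_rpow_of_nonneg h1',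
          ← ENNReal.prod_rpow_of_nonneg h0.le, Finset.prod_mul_distrib]
        ring

/-- Splitting by the codeword `x` of `v` reduces to the pointwise bound, whose sum over all `(x, y)`
is an `n`-th power. -/
theorem random_coding {ρ : ℝ} (h0 : 0 < ρ) (h1 : ρ < 1) (v : Fin k → V)
    (W : Finset (Fin k → V)) (r : (Fin k → V) → ℝ≥0∞) {l : PMF (V × V)}
    (hW : ∀ w ∈ W, empirical (fun t => (v t, w t)) = l) :
    ∑ s : Network M.c k n, (Fintype.card (Network M.c k n) : ℝ≥0∞)⁻¹ *
        ∑' y : Fin n → Y, M.likelihood (M.codeword s v) y ^ (1 - ρ) *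
          (∑ w ∈ W, r w * M.likelihood (M.codeword s w) y) ^ ρ ≤
      (∑ w ∈ W, r w) ^ ρ * affinity ρ (M.lawP (empirical v)) (M.lawQ l) ^ n := by
  calc _ = ∑ s : Network M.c k n, ∑' y : Fin n → Y, ∑' x : Fin n → X,
        (if M.codeword s v = x then
        (Fintype.card (Network M.c k n) : ℝ≥0∞)⁻¹ else 0) * (M.likelihood x y ^ (1 - ρ) *
          (∑ w ∈ W, r w * M.likelihood (M.codeword s w) y) ^ ρ) := by
        refine Finset.sum_congr rfl fun s _ => ?_
        rw [← ENNReal.tsum_mul_left]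
        refine tsum_congr fun y => ?_
        rw [tsum_eq_single (M.codeword s v) (by intro x hx; simp [hx.symm])]
        simp
    _ = ∑' y : Fin n → Y, ∑' x : Fin n → X, ∑ s : Network M.c k n,
        (if M.codeword s v = x then
        (Fintype.card (Network M.c k n) : ℝ≥0∞)⁻¹ else 0) * (M.likelihood x y ^ (1 - ρ) *
          (∑ w ∈ W, r w * M.likelihood (M.codeword s w) y) ^ ρ) := by
        simp only [← tsum_fintype (L := .unconditional _)]
        rw [ENNReal.tsum_comm]
        exact tsum_congr fun y => ENNReal.tsum_comm
    _ ≤ ∑' y : Fin n → Y, ∑' x : Fin n → X, (∑ w ∈ W, r w) ^ ρ *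
        ∏ ℓ, (M.lawP (empirical v) (x ℓ, y ℓ) ^ (1 - ρ) * M.lawQ l (x ℓ, y ℓ) ^ ρ) :=
        ENNReal.tsum_le_tsum fun y => ENNReal.tsum_le_tsum fun x =>
          M.random_coding_pointwise h0 h1 v W r hW x y
    _ = _ := by
        simp only [ENNReal.tsum_mul_left]
        congr 1
        have := tsum_pi_prod fun (_ : Fin n) a =>
          M.lawP (empirical v) a ^ (1 - ρ) * M.lawQ l a ^ ρ
        rw [Finset.prod_const, Finset.card_univ, Fintype.card_fin] at this
        rw [affinity, ← this, ENNReal.tsum_comm, ← ENNReal.tsum_prod,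
          ← (Equiv.arrowProdEquivProdArrow (Fin n) (fun _ => X) (fun _ => Y)).tsum_eq]
        rfl

end RandomNetwork

end Model

/-! ### Typical target vectors -/

/-- Variances of independent centred variables add: in the induction the cross term vanishes by
`hf`. -/
theorem sum_prod_mul_sum_sq {α : Type*} [Fintype α] (p f : α → ℝ) (hp : ∑ a, p a = 1)
    (hf : ∑ a, p a * f a = 0) (k : ℕ) :
    ∑ v : Fin k → α, (∏ t, p (v t)) * (∑ t, f (v t)) ^ 2 = k * ∑ a, p a * f a ^ 2 := by
  induction k with
  | zero => simp
  | succ k ih =>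
    have h1 : ∑ v : Fin k → α, ∏ t, p (v t) = 1 := by
      rw [sum_pi_prod fun _ => p]; simp [hp]
    rw [← (Fin.consEquiv fun _ => α).sum_comp, Fintype.sum_prod_type]
    simp only [Fin.consEquiv, Equiv.coe_fn_mk, Fin.prod_univ_succ, Fin.sum_univ_succ,
      Fin.cons_zero, Fin.cons_succ]
    have : ∀ a (v : Fin k → α), p a * (∏ t, p (v t)) * (f a + ∑ t, f (v t)) ^ 2 =
        p a * f a ^ 2 * (∏ t, p (v t)) +
          p a * f a * (2 * ((∏ t, p (v t)) * ∑ t, f (v t))) +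
            p a * ((∏ t, p (v t)) * (∑ t, f (v t)) ^ 2) := fun a v => by ring
    simp only [this, Finset.sum_add_distrib, ← Finset.mul_sum, ← Finset.sum_mul, h1, hf, hp, ih]
    push_cast; ring

namespace Model

variable {V X Y : Type*} (M : Model V X Y)

theorem priorProb_ne_top {k : ℕ} (v : Fin k → V) : M.priorProb v ≠ ∞ :=
  ENNReal.prod_ne_top fun _ _ => M.prior.apply_ne_top _

theorem priorProb_toReal {k : ℕ} (v : Fin k → V) :
    (M.priorProb v).toReal = ∏ t, (M.prior (v t)).toReal := ENNReal.toReal_prod ..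

theorem prior_ne_zero_of_priorProb {k : ℕ} {v : Fin k → V} (h : M.priorProb v ≠ 0) (t : Fin k) :
    M.prior (v t) ≠ 0 :=
  Finset.prod_ne_zero_iff.1 h t (Finset.mem_univ t)

theorem tsum_likelihood {n : ℕ} (x : Fin n → X) : ∑' y, M.likelihood x y = 1 := by
  simp only [likelihood]
  rw [tsum_pi_prod fun ℓ => M.noise (x ℓ)]
  simp [PMF.tsum_coe]

variable [Fintype V]

theorem sum_priorProb (k : ℕ) : ∑ v : Fin k → V, M.priorProb v = 1 := by
  simp only [priorProb]
  rw [sum_pi_prod fun _ => M.prior]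
  simp [sum_coe_eq_one]

-- Chebyshev's inequality for each letter frequency; the letter variances are at most `p(a)`, so
-- they sum to at most `1`.
open Classical in
theorem sum_priorProb_atypical_le {k : ℕ} [NeZero k] {ε : ℝ} (hε : 0 < ε) :
    ∑ v : Fin k → V, M.priorProb v *
      (if ∀ a, |(empirical v a).toReal - (M.prior a).toReal| < ε then 0 else 1) ≤
        ENNReal.ofReal (1 / (k * ε ^ 2)) := by
  have hk : (0 : ℝ) < k := by exact_mod_cast Nat.pos_of_ne_zero (NeZero.ne k)
  set p : V → ℝ := fun a => (M.prior a).toReal with hp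
  have hp0 : ∀ a, 0 ≤ p a := fun a => ENNReal.toReal_nonneg
  have hp1 : ∑ a, p a = 1 := sum_toReal_eq_one _
  set f : V → V → ℝ := fun a b => (if b = a then 1 else 0) - p a with hf
  have hmean : ∀ a, ∑ b, p b * f a b = 0 := fun a => by
    simp [hf, mul_sub, ← Finset.sum_mul, hp1]
  have hvar : ∀ a, ∑ b, p b * f a b ^ 2 ≤ p a := fun a => by
    have : ∀ b, p b * f a b ^ 2 = (if b = a then p b else 0) * (1 - 2 * p a) + p b * p a ^ 2 := by
      intro b
      simp only [hf]
      split_ifs with h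
      · ring
      · ring
    rw [Finset.sum_congr rfl fun b _ => this b, Finset.sum_add_distrib, ← Finset.sum_mul,
      ← Finset.sum_mul, hp1]
    simp only [Finset.sum_ite_eq', Finset.mem_univ, if_true]
    nlinarith [hp0 a, sq_nonneg (p a)]
  have hdev : ∀ (v : Fin k → V) a, ∑ t, f a (v t) = k * ((empirical v a).toReal - p a) := by
    intro v a
    rw [sum_eq_mul_sum_empirical]
    simp only [hf, mul_sub, Finset.sum_sub_distrib, ← Finset.sum_mul, sum_toReal_eq_one]
    simp
  have hterm : ∀ v : Fin k → V, M.priorProb v *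
      (if ∀ a, |(empirical v a).toReal - (M.prior a).toReal| < ε then 0 else 1) ≤
      ENNReal.ofReal (∑ a, (∏ t, p (v t)) * (∑ t, f a (v t)) ^ 2 / (k * ε) ^ 2) := by
    intro v
    split_ifs with h
    · simp
    · push Not at h
      obtain ⟨a, ha⟩ := h
      have hpr : M.priorProb v = ENNReal.ofReal (∏ t, p (v t)) := by
        rw [hp, ← ENNReal.toReal_prod]
        exact (ENNReal.ofReal_toReal (M.priorProb_ne_top v)).symm
      have hpn : 0 ≤ ∏ t, p (v t) := Finset.prod_nonneg fun t _ => hp0 _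
      rw [mul_one, hpr]
      refine ENNReal.ofReal_le_ofReal (le_trans ?_ (Finset.single_le_sum
        (fun b _ => div_nonneg (mul_nonneg hpn (sq_nonneg _)) (sq_nonneg _)) (Finset.mem_univ a)))
      rw [hdev, le_div_iff₀ (by positivity)]
      refine mul_le_mul_of_nonneg_left ?_ hpn
      rw [mul_pow, mul_pow]
      refine mul_le_mul_of_nonneg_left ?_ (sq_nonneg _)
      rw [← sq_abs ((empirical v a).toReal - p a)]
      exact pow_le_pow_left₀ hε.le ha 2
  refine (Finset.sum_le_sum fun v _ => hterm v).trans ?_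
  rw [← ENNReal.ofReal_sum_of_nonneg fun v _ => Finset.sum_nonneg fun a _ => div_nonneg
    (mul_nonneg (Finset.prod_nonneg fun t _ => hp0 _) (sq_nonneg _)) (sq_nonneg _)]
  apply ENNReal.ofReal_le_ofReal
  rw [Finset.sum_comm]
  simp only [← Finset.sum_div, sum_prod_mul_sum_sq p _ hp1 (hmean _), ← Finset.mul_sum]
  have : ∑ a, ∑ b, p b * f a b ^ 2 ≤ 1 := (Finset.sum_le_sum fun a _ => hvar a).trans_eq hp1
  rw [div_le_div_iff₀ (by positivity) (by positivity)]
  have h2 : (k : ℝ) * (∑ a, ∑ b, p b * f a b ^ 2) ≤ k := by nlinarith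
  calc _ ≤ (k : ℝ) * (k * ε ^ 2) := by gcongr
    _ = _ := by ring

/-! ### The number of target vectors of a given joint type -/

theorem card_mul_growth {k : ℕ} [NeZero k] (v w : Fin k → V) :
    k * M.growth (empirical fun t => (v t, w t)) =
      ∑ t, (-Real.log (empirical (fun t => (v t, w t)) (v t, w t)).toReal +
        Real.log (empirical v (v t)).toReal - Real.log (M.prior (v t)).toReal +
          Real.log (M.prior (w t)).toReal) := by
  set l := empirical fun t => (v t, w t) with hl
  have h1 : l.map Prod.fst = empirical v := map_empirical _ _
  have h2 : l.map Prod.snd = empirical w := map_empirical _ _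
  have e0 := sum_eq_mul_sum_empirical (fun t => (v t, w t)) fun p => Real.log (l p).toReal
  have e1 := sum_eq_mul_sum_empirical v fun a => Real.log (empirical v a).toReal
  have e2 := sum_eq_mul_sum_empirical v fun a => Real.log (M.prior a).toReal
  have e3 := sum_eq_mul_sum_empirical w fun a => Real.log (M.prior a).toReal
  rw [Finset.sum_add_distrib, Finset.sum_sub_distrib, Finset.sum_add_distrib,
    Finset.sum_neg_distrib, e0, e1, e2, e3, growth, h1, h2, ← hl]
  simp only [Real.negMulLog, neg_mul, Finset.sum_neg_distrib]
  ring

/-- The last product is the probability of `w` given `v` under the conditional law of the joint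
type. -/
theorem priorProb_div_eq {k : ℕ} [NeZero k] {v w : Fin k → V} (hv : M.priorProb v ≠ 0)
    (hw : M.priorProb w ≠ 0) :
    (M.priorProb w).toReal / (M.priorProb v).toReal =
      Real.exp (k * M.growth (empirical fun t => (v t, w t))) *
        ∏ t, (empirical (fun t => (v t, w t)) (v t, w t)).toReal / (empirical v (v t)).toReal := by
  rw [card_mul_growth, Real.exp_sum, ← Finset.prod_mul_distrib, priorProb_toReal, priorProb_toReal,
    ← Finset.prod_div_distrib]
  refine Finset.prod_congr rfl fun t _ => ?_
  have pos : ∀ {α : Type _} {p : PMF α} {a : α}, p a ≠ 0 → 0 < (p a).toReal :=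
    fun h => ENNReal.toReal_pos h (PMF.apply_ne_top _ _)
  have p1 := pos (empirical_apply_ne_zero (fun t => (v t, w t)) t)
  have p2 := pos (empirical_apply_ne_zero v t)
  have p3 := pos (M.prior_ne_zero_of_priorProb hv t)
  have p4 := pos (M.prior_ne_zero_of_priorProb hw t)
  rw [Real.exp_add, Real.exp_sub, Real.exp_add, Real.exp_neg, Real.exp_log p1, Real.exp_log p2,
    Real.exp_log p3, Real.exp_log p4]
  field_simp

/-- The conditional probabilities of all `w` given `v` sum to `1`, so no count of the type class is
needed. -/
theorem sum_priorProb_div_le {k : ℕ} [NeZero k] {v : Fin k → V} (hv : M.priorProb v ≠ 0)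
    {l : PMF (V × V)} (W : Finset (Fin k → V)) (hW : ∀ w ∈ W,
      M.priorProb w ≠ 0 ∧ empirical (fun t => (v t, w t)) = l) :
    ∑ w ∈ W, M.priorProb w / M.priorProb v ≤ ENNReal.ofReal (Real.exp (k * M.growth l)) := by
  classical
  rcases W.eq_empty_or_nonempty with rfl | ⟨w₀, hw₀⟩
  · simp
  have hfst : l.map Prod.fst = empirical v := by
    rw [← (hW w₀ hw₀).2, map_empirical]
  have hterm : ∀ w ∈ W, M.priorProb w / M.priorProb v = ENNReal.ofReal
      (Real.exp (k * M.growth l) * ∏ t, (l (v t, w t)).toReal / (empirical v (v t)).toReal) := by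
    intro w hw
    have := M.priorProb_div_eq hv (hW w hw).1
    rw [(hW w hw).2] at this
    rw [← this, ENNReal.ofReal_div_of_pos (ENNReal.toReal_pos hv (M.priorProb_ne_top v)),
      ENNReal.ofReal_toReal (M.priorProb_ne_top _), ENNReal.ofReal_toReal (M.priorProb_ne_top _)]
  rw [Finset.sum_congr rfl hterm, ← ENNReal.ofReal_sum_of_nonneg fun w _ => by positivity]
  apply ENNReal.ofReal_le_ofReal
  rw [← Finset.mul_sum]
  refine mul_le_of_le_one_right (Real.exp_pos _).le ?_
  refine (Finset.sum_le_sum_of_subset_of_nonneg (Finset.subset_univ W)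
    fun w _ _ => by positivity).trans ?_
  rw [sum_pi_prod fun t b => (l (v t, b)).toReal / (empirical v (v t)).toReal]
  refine (Finset.prod_eq_one fun t _ => ?_).le
  rw [← Finset.sum_div, div_eq_one_iff_eq (ENNReal.toReal_ne_zero.2
    ⟨empirical_apply_ne_zero v t, PMF.apply_ne_top _ _⟩), ← hfst, PMF.map_apply, tsum_fintype,
    Fintype.sum_prod_type, ← ENNReal.toReal_sum fun _ _ => PMF.apply_ne_top _ _]
  congr 1
  symm
  rw [Finset.sum_eq_single (v t) (by intro b _ hb; simp [hb.symm]) (by simp)]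
  simp

/-! ### The union bound -/

open Classical in
/-- The probability, given `v`, that a vector outside the tolerable distortion region of `v` is at
least as likely a posteriori as `v`. -/
def confusionProb [DecidableEq V] (D : ℝ) {k n : ℕ} (s : Network M.c k n) (v : Fin k → V) : ℝ≥0∞ :=
  ∑' y : Fin n → Y, if ∃ w, ¬ Tolerable D v w ∧ M.priorProb v * M.likelihood (M.codeword s v) y ≤
    M.priorProb w * M.likelihood (M.codeword s w) y then M.likelihood (M.codeword s v) y else 0

/-- An erroneous MAP output is itself a rival at least as likely as `v`. The bound does not involve
`g`, so it covers every rule for ties. -/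
theorem errorProb_le [DecidableEq V] (D : ℝ) {k n : ℕ} {s : Network M.c k n}
    {g : (Fin n → Y) → (Fin k → V)} (hg : M.IsMAP s g) :
    M.errorProb D s g ≤ ∑ v, M.priorProb v * M.confusionProb D s v := by
  unfold errorProb confusionProb
  gcongr with v _ y
  split_ifs with h1 h2 h2
  · exact zero_le
  · exact le_rfl
  · exact le_rfl
  · exact (h2 ⟨g y, h1, hg y v⟩).elim

theorem confusionProb_le_one [DecidableEq V] (D : ℝ) {k n : ℕ} (s : Network M.c k n)
    (v : Fin k → V) : M.confusionProb D s v ≤ 1 := by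
  rw [← M.tsum_likelihood (M.codeword s v)]
  unfold confusionProb
  gcongr with y
  split_ifs
  · exact le_rfl
  · exact zero_le

open Classical in
/-- The vectors of positive prior probability outside the tolerable distortion region of `v`. -/
def rivals [DecidableEq V] (D : ℝ) {k : ℕ} (v : Fin k → V) : Finset (Fin k → V) :=
  Finset.univ.filter fun w => ¬ Tolerable D v w ∧ M.priorProb w ≠ 0

open Classical in
/-- The joint types of `v` with its rivals. -/
def rivalTypes [DecidableEq V] (D : ℝ) {k : ℕ} [NeZero k] (v : Fin k → V) :
    Finset (PMF (V × V)) :=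
  (M.rivals D v).image fun w => empirical fun t => (v t, w t)

-- Gallager's bound, applied to each joint type separately so that `ρ` may depend on the type.
open Classical in
theorem confusionProb_le [DecidableEq V] (D : ℝ) {k n : ℕ} [NeZero k] (s : Network M.c k n)
    {v : Fin k → V} (hv : M.priorProb v ≠ 0) (ρ : PMF (V × V) → ℝ) (h0 : ∀ l, 0 < ρ l) :
    M.confusionProb D s v ≤ ∑ l ∈ M.rivalTypes D v, ∑' y : Fin n → Y,
      M.likelihood (M.codeword s v) y ^ (1 - ρ l) *
        (∑ w ∈ (M.rivals D v).filter fun w => (empirical fun t => (v t, w t)) = l,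
          M.priorProb w / M.priorProb v * M.likelihood (M.codeword s w) y) ^ ρ l := by
  have hswap : ∀ f : PMF (V × V) → (Fin n → Y) → ℝ≥0∞,
      ∑ l ∈ M.rivalTypes D v, ∑' y, f l y = ∑' y, ∑ l ∈ M.rivalTypes D v, f l y := fun f =>
    (Summable.tsum_finsetSum fun _ _ => ENNReal.summable).symm
  rw [hswap, confusionProb]
  refine ENNReal.tsum_le_tsum fun y => ?_
  split_ifs with h
  swap
  · exact zero_le
  obtain ⟨w, hT, hw⟩ := h
  by_cases hy : M.likelihood (M.codeword s v) y = 0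
  · rw [hy]; exact zero_le
  -- A vector of prior zero cannot beat `v` where the likelihood of `v` is positive.
  have hw0 : M.priorProb w ≠ 0 := by
    intro h
    rw [h, zero_mul, nonpos_iff_eq_zero] at hw
    exact mul_ne_zero hv hy hw
  have hwr : w ∈ M.rivals D v := Finset.mem_filter.2 ⟨Finset.mem_univ _, hT, hw0⟩
  set l := empirical fun t => (v t, w t) with hl
  have hlt : l ∈ M.rivalTypes D v := Finset.mem_image.2 ⟨w, hwr, rfl⟩
  have hle : M.likelihood (M.codeword s v) y ≤
      ∑ w ∈ (M.rivals D v).filter fun w => (empirical fun t => (v t, w t)) = l,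
        M.priorProb w / M.priorProb v * M.likelihood (M.codeword s w) y := by
    have hmem : w ∈ (M.rivals D v).filter fun w => (empirical fun t => (v t, w t)) = l :=
      Finset.mem_filter.2 ⟨hwr, rfl⟩
    refine le_trans ?_ (Finset.single_le_sum (f := fun w => M.priorProb w / M.priorProb v *
      M.likelihood (M.codeword s w) y) (fun _ _ => zero_le) hmem)
    rw [ENNReal.mul_comm_div, ← mul_div_assoc, ENNReal.le_div_iff_mul_le (Or.inl hv)
      (Or.inl (M.priorProb_ne_top v)), mul_comm]
    exact hw
  refine le_trans ?_ (Finset.single_le_sum (f := fun l =>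
    M.likelihood (M.codeword s v) y ^ (1 - ρ l) *
    (∑ w ∈ (M.rivals D v).filter fun w => (empirical fun t => (v t, w t)) = l,
      M.priorProb w / M.priorProb v * M.likelihood (M.codeword s w) y) ^ ρ l)
        (fun _ _ => zero_le) hlt)
  have hfin : M.likelihood (M.codeword s v) y ≠ ∞ :=
    ENNReal.prod_ne_top fun _ _ => PMF.apply_ne_top _ _
  calc M.likelihood (M.codeword s v) y
      = M.likelihood (M.codeword s v) y ^ (1 - ρ l) * M.likelihood (M.codeword s v) y ^ ρ l := by
        rw [← ENNReal.rpow_add _ _ hy hfin]; simp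
    _ ≤ _ := by
        have := (h0 l).le
        gcongr

theorem rivalTypes_subset_confusable [DecidableEq V] {D : ℝ} {k : ℕ} [NeZero k] {v : Fin k → V}
    {l : PMF (V × V)} (hl : l ∈ M.rivalTypes D v) :
    l ∈ M.confusable D ∧ l.map Prod.fst = empirical v := by
  classical
  obtain ⟨w, hw, rfl⟩ := Finset.mem_image.1 hl
  obtain ⟨-, hT, hw0⟩ := Finset.mem_filter.1 hw
  refine ⟨⟨fun b hb => ?_, ?_⟩, map_empirical _ _⟩
  · rw [map_empirical]
    by_contra hne
    rw [← ne_eq, ← PMF.mem_support_iff, empirical, PMF.mem_support_map_iff] at hne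
    obtain ⟨t, -, rfl⟩ := hne
    exact M.prior_ne_zero_of_priorProb hw0 t hb
  · rw [Tolerable, not_lt] at hT
    have hk : (k : ℝ) ≠ 0 := by exact_mod_cast NeZero.ne k
    have h := sum_eq_mul_sum_empirical (fun t => (v t, w t)) fun p => if p.1 ≠ p.2 then 1 else 0
    have hd : ∑ t, (if v t ≠ w t then (1 : ℝ) else 0) = hammingDist v w := by
      rw [hammingDist, Finset.sum_ite]; simp
    simp only [mul_ite, mul_one, mul_zero] at h
    rw [hd] at h
    rw [h, mul_div_cancel_left₀ _ hk] at hT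
    refine (ENNReal.ofReal_le_ofReal hT).trans ?_
    rw [ENNReal.ofReal_sum_of_nonneg fun p _ => by split_ifs <;> simp]
    refine Finset.sum_le_sum fun p _ => ?_
    split_ifs
    · rw [ENNReal.ofReal_toReal (PMF.apply_ne_top _ _)]
    · simp

theorem average_confusionProb_le [DecidableEq V] (D : ℝ) {k n : ℕ} [NeZero k]
    {v : Fin k → V} (hv : M.priorProb v ≠ 0) (ρ : PMF (V × V) → ℝ) (h0 : ∀ l, 0 < ρ l)
    (h1 : ∀ l, ρ l < 1) :
    ∑ s : Network M.c k n, (Fintype.card (Network M.c k n) : ℝ≥0∞)⁻¹ * M.confusionProb D s v ≤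
      ∑ l ∈ M.rivalTypes D v, ENNReal.ofReal (Real.exp (k * M.growth l)) ^ ρ l *
        affinity (ρ l) (M.lawP (empirical v)) (M.lawQ l) ^ n := by
  classical
  calc _ ≤ ∑ s : Network M.c k n, (Fintype.card (Network M.c k n) : ℝ≥0∞)⁻¹ * _ :=
        Finset.sum_le_sum fun s _ => mul_le_mul_right (M.confusionProb_le D s hv ρ h0) _
    _ ≤ _ := by
        simp only [Finset.mul_sum]
        rw [Finset.sum_comm]
        refine Finset.sum_le_sum fun l _ => ?_
        refine (M.random_coding (h0 l) (h1 l) v _ (fun w => M.priorProb w / M.priorProb v)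
          (l := l) fun w hw => (Finset.mem_filter.1 hw).2).trans ?_
        gcongr
        · exact (h0 l).le
        · refine M.sum_priorProb_div_le hv _ fun w hw => ?_
          obtain ⟨h, h'⟩ := Finset.mem_filter.1 hw
          exact ⟨(Finset.mem_filter.1 h).2.2, h'⟩

/-! ### Achievability -/

/-- This constant absorbs the rounding of `n * R` to the integer `k`. -/
theorem exists_abs_growth_le : ∃ C, 0 ≤ C ∧ ∀ l, |M.growth l| ≤ C := by
  obtain ⟨C, hC⟩ := isCompact_univ.exists_bound_of_continuousOn M.continuous_growth.continuousOn
  refine ⟨C, ?_, fun l => hC l trivial⟩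
  obtain ⟨b, -⟩ := M.prior.support_nonempty
  exact (norm_nonneg _).trans (hC (PMF.pure (b, b)) trivial)

theorem type_bound {N m k n : ℕ} {R δ C a : ℝ} (hδ : 0 < δ) (hC : 0 ≤ C) (hm : m ≤ N)
    (hk0 : n * R ≤ k) (hk1 : k ≤ n * R + 1) {l : PMF (V × V)} (hgC : |M.growth l| ≤ C)
    (hg : R * M.growth l ≤ a - δ)
    (ha : ENNReal.ofReal a ≤ klApprox m (M.lawP (l.map Prod.fst)) (M.lawQ l)) :
    ENNReal.ofReal (Real.exp (k * M.growth l)) ^ ((m : ℝ) + 2)⁻¹ *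
        affinity ((m : ℝ) + 2)⁻¹ (M.lawP (l.map Prod.fst)) (M.lawQ l) ^ n ≤
      ENNReal.ofReal (Real.exp (C - n * (δ / (N + 2)))) := by
  set ρ := ((m : ℝ) + 2)⁻¹ with hρ
  have hρ0 : 0 < ρ := inv_add_two_pos m
  have hρ1 : ρ < 1 := inv_add_two_lt_one m
  have haff : affinity ρ (M.lawP (l.map Prod.fst)) (M.lawQ l) ≤
      ENNReal.ofReal (Real.exp (-(ρ * a))) := by
    refine affinity_le hρ0 hρ1.le ?_
    calc ENNReal.ofReal (ρ * a) = ENNReal.ofReal ρ * ENNReal.ofReal a := ENNReal.ofReal_mul hρ0.le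
      _ ≤ ENNReal.ofReal ρ * klApprox m (M.lawP (l.map Prod.fst)) (M.lawQ l) := by gcongr
      _ = _ := by
        rw [klApprox, ← ofReal_add_two, ← mul_assoc, ← ENNReal.ofReal_mul hρ0.le, hρ,
          inv_mul_cancel₀ (by positivity)]
        simp
  -- Positive growth uses `k ≤ n * R + 1`, negative growth uses `n * R ≤ k`.
  have hkg : k * M.growth l ≤ n * (R * M.growth l) + C := by
    obtain ⟨h1, h2⟩ := abs_le.1 hgC
    rcases le_total 0 (M.growth l) with h | h <;> nlinarith
  have hng : (n : ℝ) * (R * M.growth l) ≤ n * (a - δ) := by gcongr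
  -- Since `m ≤ N`, the exponent `ρ` is bounded below, which makes the decay rate `δ / (N + 2)`
  -- common to all types.
  have hNρ : ((N : ℝ) + 2)⁻¹ ≤ ρ := by rw [hρ]; gcongr
  calc _ ≤ ENNReal.ofReal (Real.exp (k * M.growth l)) ^ ρ *
        ENNReal.ofReal (Real.exp (-(ρ * a))) ^ n := by gcongr
    _ = ENNReal.ofReal (Real.exp (ρ * (k * M.growth l - n * a))) := by
        rw [ENNReal.ofReal_rpow_of_pos (Real.exp_pos _), ← Real.exp_mul,
          ← ENNReal.ofReal_pow (Real.exp_pos _).le, ← Real.exp_nat_mul,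
          ← ENNReal.ofReal_mul (Real.exp_pos _).le, ← Real.exp_add]
        congr 2; ring
    _ ≤ _ := by
        apply ENNReal.ofReal_le_ofReal
        apply Real.exp_le_exp.2
        have h1 : ρ * (k * M.growth l - n * a) ≤ ρ * (C - n * δ) :=
          mul_le_mul_of_nonneg_left (by linarith) hρ0.le
        have h2 : ρ * C ≤ C := mul_le_of_le_one_left hC hρ1.le
        have h3 : ((N : ℝ) + 2)⁻¹ * (n * δ) ≤ ρ * (n * δ) := by gcongr
        rw [div_eq_mul_inv]
        linarith

theorem exists_network_errorProb_le [DecidableEq V] {D R : ℝ} (hR : 0 < R)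
    (h : ENNReal.ofReal R < M.lowerBound D) :
    ∃ C η ε : ℝ, 0 < η ∧ 0 < ε ∧ ∀ (k n : ℕ) [NeZero k], n * R ≤ k → k ≤ n * R + 1 →
      ∃ s : Network M.c k n, ∀ g, M.IsMAP s g → M.errorProb D s g ≤
        ENNReal.ofReal (1 / (k * ε ^ 2)) + ENNReal.ofReal
          (((k : ℝ) + 1) ^ Fintype.card (V × V) * Real.exp (C - n * η)) := by
  classical
  obtain ⟨N, δ, ε, hδ, hε, hex⟩ := M.exists_uniform_growth_le hR h
  obtain ⟨C, hC, hgC⟩ := M.exists_abs_growth_le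
  refine ⟨C, δ / (N + 2), ε, by positivity, hε, fun k n _ hk0 hk1 => ?_⟩
  -- The exponent must be defined for every type; `0` is a dummy value where no condition applies.
  have hex' : ∀ l : PMF (V × V), ∃ m : ℕ, l ∈ M.confusable D →
      (∀ a, |(l.map Prod.fst a).toReal - (M.prior a).toReal| < ε) → m ≤ N ∧ ∃ a : ℝ,
        R * M.growth l ≤ a - δ ∧
          ENNReal.ofReal a ≤ klApprox m (M.lawP (l.map Prod.fst)) (M.lawQ l) := by
    intro l
    by_cases hl : l ∈ M.confusable D ∧
        ∀ a, |(l.map Prod.fst a).toReal - (M.prior a).toReal| < ε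
    · obtain ⟨m, hm, ha⟩ := hex l hl.1 hl.2
      exact ⟨m, fun _ _ => ⟨hm, ha⟩⟩
    · exact ⟨0, fun h1 h2 => (hl ⟨h1, h2⟩).elim⟩
  choose m hm using hex'
  set c₀ : ℝ≥0∞ := (Fintype.card (Network M.c k n) : ℝ≥0∞)⁻¹
  have hcard0 : (Fintype.card (Network M.c k n) : ℝ≥0∞) ≠ 0 := by
    exact_mod_cast Fintype.card_ne_zero
  have hc₀ : ∑ _s : Network M.c k n, c₀ = 1 := by
    rw [Finset.sum_const, Finset.card_univ, nsmul_eq_mul]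
    exact ENNReal.mul_inv_cancel hcard0 (ENNReal.natCast_ne_top _)
  set β : ℝ≥0∞ := ENNReal.ofReal
    (((k : ℝ) + 1) ^ Fintype.card (V × V) * Real.exp (C - n * (δ / (N + 2)))) with hβ
  set atyp : (Fin k → V) → ℝ≥0∞ := fun v =>
    if ∀ a, |(empirical v a).toReal - (M.prior a).toReal| < ε then 0 else 1 with hatyp
  have hv : ∀ v : Fin k → V, M.priorProb v *
      ∑ s : Network M.c k n, c₀ * M.confusionProb D s v ≤ M.priorProb v * (atyp v + β) := by
    intro v
    by_cases hv0 : M.priorProb v = 0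
    · simp [hv0]
    refine mul_le_mul_right ?_ _
    by_cases ht : ∀ a, |(empirical v a).toReal - (M.prior a).toReal| < ε
    · refine le_trans ?_ (le_add_of_nonneg_left zero_le)
      refine (M.average_confusionProb_le D hv0 (fun l => ((m l : ℝ) + 2)⁻¹)
        (fun l => inv_add_two_pos _) (fun l => inv_add_two_lt_one _)).trans ?_
      have hterm : ∀ l ∈ M.rivalTypes D v,
          ENNReal.ofReal (Real.exp (k * M.growth l)) ^ ((m l : ℝ) + 2)⁻¹ *
            affinity ((m l : ℝ) + 2)⁻¹ (M.lawP (empirical v)) (M.lawQ l) ^ n ≤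
          ENNReal.ofReal (Real.exp (C - n * (δ / (N + 2)))) := by
        intro l hl
        obtain ⟨hlc, hl1⟩ := M.rivalTypes_subset_confusable hl
        obtain ⟨hmN, a, ha1, ha2⟩ := hm l hlc (by rwa [hl1])
        rw [← hl1]
        exact M.type_bound hδ hC hmN hk0 hk1 (hgC l) ha1 ha2
      refine (Finset.sum_le_sum hterm).trans ?_
      rw [Finset.sum_const, nsmul_eq_mul, hβ, ENNReal.ofReal_mul (by positivity)]
      gcongr
      have hcard := card_image_empirical_le (M.rivals D v) fun w t => (v t, w t)
      have : ENNReal.ofReal (((k : ℝ) + 1) ^ Fintype.card (V × V)) =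
          (((k + 1) ^ Fintype.card (V × V) : ℕ) : ℝ≥0∞) := by
        rw [← ENNReal.ofReal_natCast]; push_cast; rfl
      rw [this]
      exact_mod_cast hcard
    · refine le_trans ?_ (le_add_of_nonneg_right zero_le)
      rw [hatyp]
      simp only [ht, if_false]
      rw [← hc₀]
      exact Finset.sum_le_sum fun s _ => mul_le_of_le_one_right zero_le
        (M.confusionProb_le_one D s v)
  have havg : ∑ s : Network M.c k n, c₀ * ∑ v, M.priorProb v * M.confusionProb D s v ≤
      ∑ _s : Network M.c k n, c₀ * (ENNReal.ofReal (1 / (k * ε ^ 2)) + β) := by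
    calc _ = ∑ v : Fin k → V, M.priorProb v *
          ∑ s : Network M.c k n, c₀ * M.confusionProb D s v := by
          simp only [Finset.mul_sum]
          rw [Finset.sum_comm]
          simp only [mul_left_comm c₀]
      _ ≤ ∑ v : Fin k → V, M.priorProb v * (atyp v + β) := Finset.sum_le_sum fun v _ => hv v
      _ ≤ ENNReal.ofReal (1 / (k * ε ^ 2)) + β := by
          simp only [mul_add, Finset.sum_add_distrib, ← Finset.sum_mul, M.sum_priorProb, one_mul]
          gcongr
          exact M.sum_priorProb_atypical_le hε
      _ = _ := by rw [← Finset.sum_mul, hc₀, one_mul]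
  -- Some network does no worse than the average. It is chosen before the detector.
  obtain ⟨s, hs⟩ : ∃ s : Network M.c k n, c₀ * ∑ v, M.priorProb v * M.confusionProb D s v ≤
      c₀ * (ENNReal.ofReal (1 / (k * ε ^ 2)) + β) := by
    by_contra! hlt
    exact (ENNReal.sum_lt_sum_of_nonempty Finset.univ_nonempty fun s _ => hlt s).not_ge havg
  refine ⟨s, fun g hg => (M.errorProb_le D hg).trans ?_⟩
  exact (ENNReal.mul_le_mul_iff_right (ENNReal.inv_ne_zero.2 (ENNReal.natCast_ne_top _))
    (ENNReal.inv_ne_top.2 hcard0)).1 hs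

theorem tendsto_error_bound {R η ε : ℝ} (hR : 0 < R) (hη : 0 < η) (hε : 0 < ε) (C : ℝ) (d : ℕ) :
    Tendsto (fun n : ℕ => ENNReal.ofReal (1 / ((⌈(n : ℝ) * R⌉₊ : ℝ) * ε ^ 2)) + ENNReal.ofReal
      (((⌈(n : ℝ) * R⌉₊ : ℝ) + 1) ^ d * Real.exp (C - n * η))) atTop (𝓝 0) := by
  have hnR : Tendsto (fun n : ℕ => (n : ℝ) * R) atTop atTop :=
    tendsto_natCast_atTop_atTop.atTop_mul_const hR
  have h1 : Tendsto (fun n : ℕ => 1 / ((⌈(n : ℝ) * R⌉₊ : ℝ) * ε ^ 2)) atTop (𝓝 0) := by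
    simp only [one_div]
    exact tendsto_inv_atTop_zero.comp ((tendsto_atTop_mono (fun n => Nat.le_ceil _)
      hnR).atTop_mul_const (by positivity))
  have h2 : Tendsto (fun n : ℕ => ((⌈(n : ℝ) * R⌉₊ : ℝ) + 1) ^ d * Real.exp (C - n * η)) atTop
      (𝓝 0) := by
    have hlim := ((Real.tendsto_pow_mul_exp_neg_atTop_nhds_zero d).comp
      (tendsto_natCast_atTop_atTop.atTop_mul_const hη)).const_mul
        (((R + 2) / η) ^ d * Real.exp C)
    rw [mul_zero] at hlim
    refine tendsto_of_tendsto_of_tendsto_of_le_of_le' tendsto_const_nhds hlim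
      (Eventually.of_forall fun n => by positivity) ?_
    filter_upwards [eventually_ge_atTop 1] with n hn
    have hn1 : (1 : ℝ) ≤ n := by exact_mod_cast hn
    -- The ceiling and the extra `1` cost at most `2 ≤ 2 * n`, so the polynomial factor is a power
    -- of `n` up to a constant.
    have hc : (⌈(n : ℝ) * R⌉₊ : ℝ) + 1 ≤ (R + 2) * n := by
      have := (Nat.ceil_lt_add_one (show 0 ≤ (n : ℝ) * R by positivity)).le
      linarith
    calc ((⌈(n : ℝ) * R⌉₊ : ℝ) + 1) ^ d * Real.exp (C - n * η)
        ≤ ((R + 2) * n) ^ d * Real.exp (C - n * η) := by gcongr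
      _ = _ := by
        simp only [Function.comp]
        rw [sub_eq_add_neg, Real.exp_add]
        have : (R + 2) * n = (R + 2) / η * (n * η) := by field_simp
        rw [this, mul_pow]; ring
  have := (ENNReal.tendsto_ofReal h1).add (ENNReal.tendsto_ofReal h2)
  simpa using this

theorem achievable_of_lt_lowerBound [DecidableEq V] {D R : ℝ} (hR : 0 < R)
    (h : ENNReal.ofReal R < M.lowerBound D) : M.Achievable D R := by
  obtain ⟨C, η, ε, hη, hε, hex⟩ := M.exists_network_errorProb_le hR h
  have hs : ∀ n : ℕ, ∃ s : Network M.c ⌈(n : ℝ) * R⌉₊ n, 0 < n → ∀ g, M.IsMAP s g →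
      M.errorProb D s g ≤ ENNReal.ofReal (1 / ((⌈(n : ℝ) * R⌉₊ : ℝ) * ε ^ 2)) + ENNReal.ofReal
          (((⌈(n : ℝ) * R⌉₊ : ℝ) + 1) ^ Fintype.card (V × V) * Real.exp (C - n * η)) := by
    intro n
    -- At `n = 0` there are no positions and no empirical distributions; the empty network is used,
    -- and the limit ignores this term.
    rcases n.eq_zero_or_pos with rfl | hn
    · exact ⟨fun ℓ => ℓ.elim0, fun h => (lt_irrefl _ h).elim⟩
    · have hnR : 0 < (n : ℝ) * R := by positivity
      have : NeZero ⌈(n : ℝ) * R⌉₊ := ⟨(Nat.ceil_pos.2 hnR).ne'⟩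
      obtain ⟨s, hs⟩ := hex ⌈(n : ℝ) * R⌉₊ n (Nat.le_ceil _) (Nat.ceil_lt_add_one hnR.le).le
      exact ⟨s, fun _ => hs⟩
  choose s hs using hs
  refine ⟨s, fun g hg => ?_⟩
  refine tendsto_of_tendsto_of_tendsto_of_le_of_le' tendsto_const_nhds
    (tendsto_error_bound hR hη hε C (Fintype.card (V × V)))
    (Eventually.of_forall fun n => zero_le) ?_
  filter_upwards [eventually_gt_atTop 0] with n hn
  exact hs n hn (g n) (hg n)

end Model

end SensingCapacity

end

theorem mainTheorem6 {V X Y : Type*} [Fintype V] [DecidableEq V]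
    (M : SensingCapacity.Model V X Y) (D : ℝ) (hD : D ∈ Set.Icc (0 : ℝ) 1) :
    ((M.feasible D).Nonempty → ∃ l ∈ M.feasible D, M.quotient l = M.lowerBound D) ∧
      M.lowerBound D ≤ M.capacity D :=
  ⟨M.exists_quotient_eq_lowerBound, le_sSup fun _ hR h => M.achievable_of_lt_lowerBound hR h⟩
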